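/- **Setting.** Let $f_\theta(x)=\sum_{i=1}^m a_i\,\sigma(w_i^\top x)$, $x\in\mathbb R^d$, with parameters $\theta=((a_i,w_i))_{i\le m}\in\Theta=(\mathbb R\times\mathbb R^d)^m$ and an activation $\sigma:\mathbb R\to\mathbb R$ satisfying $\sigma(ct)=c^p\sigma(t)$ for all $c>0$, $t\in\mathbb R$, where $p>0$. The group $G=S_m\ltimes(\mathbb R_{>0})^m$ acts on $\Theta$ by permuting the neurons and by the rescalings $(a_i,w_i)\mapsto(c_i^{-p}a_i,c_iw_i)$. Fix a sample $X=(x_1,\dots,x_n)$ and put $\Phi_X(\theta)=(f_\theta(x_1),\dots,f_\theta(x_n))\in\mathbb R^n$. Let $\Theta_{\mathrm{reg}}\subset\Theta$ be an open $G$-invariant set on which $\Phi_X$ is $C^\infty$, on which $G$ acts locally freely and properly, and such that $\ker D\Phi_X(\theta)=T_\theta(G\cdot\theta)=\{(-p\,\xi_ia_i,\ \xi_iw_i)_{i\le m}:\xi\in\mathbb R^m\}$ for all $\theta\in\Theta_{\mathrm{reg}}$. Then $\mathcal M_{\mathrm{reg}}=\Theta_{\mathrm{reg}}/G$ is a Hausdorff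 smooth manifold and the quotient map $q:\Theta_{\mathrm{reg}}\to\mathcal M_{\mathrm{reg}}$ is a smooth submersion with $\ker Dq_\theta=T_\theta(G\cdot\theta)$. Let $g_\theta(u,v)=\frac1n\langle D\Phi_X(\theta)u,D\Phi_X(\theta)v\rangle$, and let $\bar g$ be the quotient metric on $\mathcal M_{\mathrm{reg}}$, i.e. $\bar g_{q(\theta)}(Dq_\theta u,Dq_\theta v)=g_\theta(u,v)$. Let $\widetilde L:\mathbb R^n\to\mathbb R$ be $C^\infty$, let $\mathcal L=\widetilde L\circ\Phi_X$ on $\Theta_{\mathrm{reg}}$, and let $\bar{\mathcal L}:\mathcal M_{\mathrm{reg}}\to\mathbb R$ be the descended loss, $\bar{\mathcal L}\circ q=\mathcal L$. For a metric $h$ and a function $f$, $\operatorname{Hess}_hf$ is the Riemannian Hessian (with respect to the Levi-Civita connection of $h$), and the Hessian operator is the $h$-self-adjoint operator $A$ with $h(A\xi,\eta)=\operatorname{Hess}_hf(\xi,\eta)$. The Hessian operator of $\bar{\mathcal L}$ with respect to $\bar g$ is called the effective Hessian. **Statement.** Let $U\subset\mathcal M_{\mathrm{reg}}$ be open and let $s:U\to\Theta_{\mathrm{reg}}$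 be a smooth section, $q\circ s=\mathrm{id}_U$. Put $\mathcal L^S:=\mathcal L\circ s$ and $g^S:=s^*\bar g$ (the pullback along $s$ of the quotient metric, the latter being viewed as the form $q^*\bar g$ on $\Theta_{\mathrm{reg}}$). Then $\mathcal L^S=\bar{\mathcal L}|_U$, the form $g^S$ is symmetric and positive definite at every point of $U$, and the following hold. 1. $\operatorname{grad}_{g^S}\mathcal L^S=\operatorname{grad}_{\bar g}\bar{\mathcal L}$ on $U$. Consequently, for every $J\subset\mathbb R$ and every curve $\gamma:J\to U$, the following are equivalent: (a) $\dot\gamma_t=-\operatorname{grad}_{\bar g}\bar{\mathcal L}(\gamma_t)$ on $J$; (b) $\dot\gamma_t=-\operatorname{grad}_{g^S}\mathcal L^S(\gamma_t)$ on $J$; (c) $\theta_t=s(\gamma_t)$ solves the gradient flow of $\mathcal L$ on the slice $s(U)$ with the metric induced by $g$, i.e. $\theta$ is differentiable on $J$, and for all $t\in J$ the velocity $\dot\theta_t$ lies in $\operatorname{Im}Ds_{\gamma_t}$ and $g_{\theta_t}(\dot\theta_t,w)=-D\mathcal L(\theta_t)[w]$ for all $w\in\operatorname{Im}Ds_{\gamma_t}$.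 2. At every critical point $z_*\in U$ of $\bar{\mathcal L}$, $\operatorname{Hess}_{g^S}\mathcal L^S(z_*)=\operatorname{Hess}_{\bar g}\bar{\mathcal L}(z_*)$. 3. Let $z_*\in U$ be a critical point of $\bar{\mathcal L}$, and let $H^S$ be the Hessian operator of $\mathcal L^S$ with respect to $g^S$ at $z_*$. Then $H^S$ is equal to the effective Hessian at $z_*$; in particular the two have the same spectrum. The linearization at $z_*$ of the vector field $-\operatorname{grad}_{\bar g}\bar{\mathcal L}$ is $-H^S$. Moreover: * If all eigenvalues of $H^S$ are positive, then $z_*$ is a strict local minimizer of $\bar{\mathcal L}$. Every $\theta\in q^{-1}(z_*)$ is a local minimizer of $\mathcal L$ that is strict modulo symmetry: for all $\theta'\in\Theta_{\mathrm{reg}}$ near $\theta$, $\mathcal L(\theta')\ge\mathcal L(\theta)$, with equality only if $q(\theta')=z_*$. The point $z_*$ is an asymptotically stable equilibrium of quotient gradient flow (from every point near $z_*$ there starts a solution on $[0,\infty)$, solutions that start near $z_*$ stay near $z_*$, and solutions on $[0,\infty)$ that start near $z_*$ converge to $z_*$). Finally, for all real $\mu>0$ and $\Lambda$ such that $\mu<\lambda<\Lambda$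 for every eigenvalue $\lambda$ of $H^S$, there is a neighbourhood $V$ of $z_*$ such that every solution $\gamma:[0,T)\to V$ of quotient gradient flow satisfies, for all $t\in[0,T)$, $$e^{-2\Lambda t}\bigl(\bar{\mathcal L}(\gamma_0)-\bar{\mathcal L}(z_*)\bigr)\le\bar{\mathcal L}(\gamma_t)-\bar{\mathcal L}(z_*)\le e^{-2\mu t}\bigl(\bar{\mathcal L}(\gamma_0)-\bar{\mathcal L}(z_*)\bigr).$$ * If $H^S$ has a negative eigenvalue, then $z_*$ is unstable for quotient gradient flow: there is a neighbourhood $W$ of $z_*$ such that arbitrarily close to $z_*$ there start solutions that leave $W$ in finite time. -/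

import Mathlib

open Set Filter Topology
open scoped Manifold ContDiff

noncomputable section

namespace ShallowNet

section Riemannian

variable {E : Type*} [NormedAddCommGroup E] [NormedSpace ℝ E]
  {M : Type*} [TopologicalSpace M] [ChartedSpace E M]
  {E' : Type*} [NormedAddCommGroup E'] [NormedSpace ℝ E']
  {M' : Type*} [TopologicalSpace M'] [ChartedSpace E' M']

/-- Fields of continuous bilinear forms on the tangent spaces of a manifold modelled on `E`. -/
abbrev TensorField (E : Type*) [NormedAddCommGroup E] [NormedSpace ℝ E]
    (M : Type*) [TopologicalSpace M] [ChartedSpace E M] : Type _ :=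
  ∀ x : M, TangentSpace 𝓘(ℝ, E) x →L[ℝ] TangentSpace 𝓘(ℝ, E) x →L[ℝ] ℝ

/-- The bilinear form `(u, v) ↦ B (A u) (A v)`. -/
def restrictForm {F F' : Type*} [NormedAddCommGroup F] [NormedSpace ℝ F] [NormedAddCommGroup F']
    [NormedSpace ℝ F'] (B : F' →L[ℝ] F' →L[ℝ] ℝ) (A : F →L[ℝ] F') : F →L[ℝ] F →L[ℝ] ℝ :=
  B.bilinearComp A A

/-- The pullback `f^* g`, i.e. `(f^* g)_x (u, v) = g_{f x} (Df_x u, Df_x v)`. -/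
def pullback (f : M → M') (g : TensorField E' M') : TensorField E M := fun x =>
  restrictForm (F := E) (F' := E') (g (f x)) (mfderiv 𝓘(ℝ, E) 𝓘(ℝ, E') f x)

theorem pullback_apply (f : M → M') (g : TensorField E' M') (x : M)
    (u v : TangentSpace 𝓘(ℝ, E) x) :
    pullback f g x u v =
      g (f x) (mfderiv 𝓘(ℝ, E) 𝓘(ℝ, E') f x u) (mfderiv 𝓘(ℝ, E) 𝓘(ℝ, E') f x v) := rfl

/-- `g_x` is an inner product: symmetric and positive definite. -/
def IsMetricAt (g : TensorField E M) (x : M) : Prop :=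
  (∀ u v, g x u v = g x v u) ∧ ∀ u, u ≠ 0 → 0 < g x u u

/-- The Riemannian gradient: for a metric `g`, the unique vector with `g_x (grad, u) = Df_x u` for
all `u` (see `apply_grad`); `(g x).inverse` is the inverse of the map `u ↦ g_x (u, ·)`. -/
def grad (g : TensorField E M) (f : M → ℝ) (x : M) : TangentSpace 𝓘(ℝ, E) x :=
  (g x).inverse (mfderiv 𝓘(ℝ, E) 𝓘(ℝ, ℝ) f x)

theorem isInvertible_of_isMetricAt [FiniteDimensional ℝ E] {g : TensorField E M} {x : M}
    (h : IsMetricAt g x) : (g x).IsInvertible := by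
  let B : E →ₗ[ℝ] (E →L[ℝ] ℝ) := (g x : E →L[ℝ] E →L[ℝ] ℝ).toLinearMap
  have hinj : Function.Injective B := by
    rw [injective_iff_map_eq_zero]
    intro u hu
    by_contra hne
    have h1 := h.2 u hne
    have h2 : g x u u = 0 := DFunLike.congr_fun hu u
    exact h1.ne' h2
  have hdim : Module.finrank ℝ E = Module.finrank ℝ (E →L[ℝ] ℝ) := by
    rw [← (LinearMap.toContinuousLinearMap (𝕜 := ℝ) (E := E) (F' := ℝ)).finrank_eq]
    exact (Subspace.dual_finrank_eq (K := ℝ) (V := E)).symm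
  let e : E ≃ₗ[ℝ] (E →L[ℝ] ℝ) := LinearEquiv.ofInjectiveOfFinrankEq B hinj hdim
  exact ⟨e.toContinuousLinearEquiv, by ext1 v; rfl⟩

theorem apply_grad [FiniteDimensional ℝ E] {g : TensorField E M} {x : M}
    (h : IsMetricAt g x) (f : M → ℝ) (u : TangentSpace 𝓘(ℝ, E) x) :
    g x (grad g f x) u = mfderiv 𝓘(ℝ, E) 𝓘(ℝ, ℝ) f x u := by
  have := (isInvertible_of_isMetricAt h).inverse_apply_eq.1 (rfl : grad g f x = grad g f x)
  exact (DFunLike.congr_fun this u).symm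

/-- The metric in the preferred chart at `x`: `G_{ij}(y)`, a form on the model space depending on
the coordinate `y`. -/
def localMetric (g : TensorField E M) (x : M) (y : E) : E →L[ℝ] E →L[ℝ] ℝ :=
  pullback (extChartAt 𝓘(ℝ, E) x).symm g y

/-- The function `f` in the preferred chart at `x`. -/
def localFun (f : M → ℝ) (x : M) (y : E) : ℝ := f ((extChartAt 𝓘(ℝ, E) x).symm y)

set_option maxSynthPendingDepth 3 in
/-- Christoffel symbols of the first kind of a metric `G` on an open piece of the model space. -/
def christoffelFirst (G : E → E →L[ℝ] E →L[ℝ] ℝ) (y : E) : E →L[ℝ] E →L[ℝ] E →L[ℝ] ℝ :=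
  let T : E →L[ℝ] E →L[ℝ] E →L[ℝ] ℝ := fderiv ℝ G y
  let flip₂ : (E →L[ℝ] E →L[ℝ] ℝ) →L[ℝ] (E →L[ℝ] E →L[ℝ] ℝ) :=
    (ContinuousLinearMap.flipₗᵢ ℝ E E ℝ).toContinuousLinearEquiv
  (1 / 2 : ℝ) • (T + T.flip - flip₂ ∘L T.flip)

theorem christoffelFirst_apply (G : E → E →L[ℝ] E →L[ℝ] ℝ) (y u v w : E) :
    christoffelFirst G y u v w =
      1 / 2 * (fderiv ℝ G y u v w + fderiv ℝ G y v u w - fderiv ℝ G y w u v) := rfl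

/-- Christoffel symbols `Γ_y (u, v)` of the Levi-Civita connection of `G`; in the coordinates this
connection is `∇_u Y = D_u Y + Γ (u, Y)`. The two lemmas below say that it is torsion free and
compatible with `G`. -/
def christoffel (G : E → E →L[ℝ] E →L[ℝ] ℝ) (y : E) : E →L[ℝ] E →L[ℝ] E :=
  ContinuousLinearMap.compL ℝ E (E →L[ℝ] ℝ) E (G y).inverse ∘L christoffelFirst G y

theorem fderiv_form_symm {G : E → E →L[ℝ] E →L[ℝ] ℝ} {y : E}
    (hG : ∀ᶠ z in 𝓝 y, ∀ u v, G z u v = G z v u) (hd : DifferentiableAt ℝ G y) (w u v : E) :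
    fderiv ℝ G y w u v = fderiv ℝ G y w v u := by
  have h1 : ∀ a b, HasFDerivAt (fun z => G z a b) (((fderiv ℝ G y).flip a).flip b) y := fun a b => by
    have h := (hd.hasFDerivAt.clm_apply (hasFDerivAt_const a y)).clm_apply (hasFDerivAt_const b y)
    convert! h using 1
    ext1 x
    simp
  have h2 : (fun z => G z u v) =ᶠ[𝓝 y] fun z => G z v u := hG.mono fun z hz => hz u v
  exact DFunLike.congr_fun ((h1 u v).unique ((h1 v u).congr_of_eventuallyEq h2)) w

theorem christoffel_torsionFree {G : E → E →L[ℝ] E →L[ℝ] ℝ} {y : E}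
    (hG : ∀ᶠ z in 𝓝 y, ∀ u v, G z u v = G z v u) (hd : DifferentiableAt ℝ G y) (u v : E) :
    christoffel G y u v = christoffel G y v u := by
  have : christoffelFirst G y u v = christoffelFirst G y v u := by
    ext1 w
    rw [christoffelFirst_apply, christoffelFirst_apply, fderiv_form_symm hG hd w u v]
    ring
  change (G y).inverse (christoffelFirst G y u v) = (G y).inverse (christoffelFirst G y v u)
  rw [this]

theorem christoffel_metric {G : E → E →L[ℝ] E →L[ℝ] ℝ} {y : E}
    (hG : ∀ᶠ z in 𝓝 y, ∀ u v, G z u v = G z v u) (hd : DifferentiableAt ℝ G y)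
    (hi : (G y).IsInvertible) (w u v : E) :
    fderiv ℝ G y w u v = G y (christoffel G y w u) v + G y u (christoffel G y w v) := by
  have h1 : ∀ a b c, G y (christoffel G y a b) c = christoffelFirst G y a b c := fun a b c => by
    have := hi.inverse_apply_eq.1 (rfl : christoffel G y a b = (G y).inverse _)
    exact (DFunLike.congr_fun this c).symm
  rw [hG.self_of_nhds u, h1, h1, christoffelFirst_apply, christoffelFirst_apply,
    fderiv_form_symm hG hd w v u, fderiv_form_symm hG hd u w v, fderiv_form_symm hG hd v w u]
  ring

/-- The Riemannian Hessian `u (v f) - (∇_u v) f` of the Levi-Civita connection of `g`, at the point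
`x`. The vector `v` is extended with constant coefficients in the preferred chart at `x`, in which
`T_x M` is the model space, so that `Hess_{ij} = ∂_i ∂_j f - Γ^k_{ij} ∂_k f`. -/
def hess (g : TensorField E M) (f : M → ℝ) (x : M) : TangentSpace 𝓘(ℝ, E) x →L[ℝ] TangentSpace 𝓘(ℝ, E) x →L[ℝ] ℝ :=
  let y₀ : E := extChartAt 𝓘(ℝ, E) x x
  (fderiv ℝ (fderiv ℝ (localFun f x)) y₀ -
    ContinuousLinearMap.compL ℝ E E ℝ (fderiv ℝ (localFun f x) y₀) ∘L
      christoffel (localMetric g x) y₀ : E →L[ℝ] E →L[ℝ] ℝ)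

/-- The Hessian operator: `g_x (hessOp u, v) = hess (u, v)`, see `apply_hessOp`. -/
def hessOp (g : TensorField E M) (f : M → ℝ) (x : M) : TangentSpace 𝓘(ℝ, E) x →L[ℝ] TangentSpace 𝓘(ℝ, E) x :=
  (g x).inverse ∘L hess g f x

theorem apply_hessOp [FiniteDimensional ℝ E] {g : TensorField E M} {x : M}
    (h : IsMetricAt g x) (f : M → ℝ) (u v : TangentSpace 𝓘(ℝ, E) x) :
    g x (hessOp g f x u) v = hess g f x u v := by
  have := (isInvertible_of_isMetricAt h).inverse_apply_eq.1
    (rfl : hessOp g f x u = (g x).inverse (hess g f x u))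
  exact (DFunLike.congr_fun this v).symm

/-- The vector field `V` in the preferred chart at `x`. -/
def localField (V : ∀ x : M, TangentSpace 𝓘(ℝ, E) x) (x : M) (y : E) : E :=
  mfderiv 𝓘(ℝ, E) 𝓘(ℝ, E) (extChartAt 𝓘(ℝ, E) x) ((extChartAt 𝓘(ℝ, E) x).symm y)
    (V ((extChartAt 𝓘(ℝ, E) x).symm y))

/-- At the point `x` the vector field `V`, read in the preferred chart at `x`, has derivative `A`. -/
def HasLinearizationAt (V : ∀ x : M, TangentSpace 𝓘(ℝ, E) x) (x : M)
    (A : TangentSpace 𝓘(ℝ, E) x →L[ℝ] TangentSpace 𝓘(ℝ, E) x) : Prop :=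
  HasFDerivAt (localField V x) (A : E →L[ℝ] E) (extChartAt 𝓘(ℝ, E) x x)

/-- Lyapunov stability of `z` for the flow of `V`: for every neighbourhood `W` of `z`, from every
point close enough to `z` there starts a solution for all times `t ≥ 0`, and every solution from that
point stays in `W`. -/
def IsLyapunovStable (V : ∀ x : M, TangentSpace 𝓘(ℝ, E) x) (z : M) : Prop :=
  ∀ W ∈ 𝓝 z, ∃ O ∈ 𝓝 z, ∀ x ∈ O,
    (∃ γ : ℝ → M, γ 0 = x ∧ IsMIntegralCurveOn γ V (Ici 0)) ∧
    ∀ (T : ℝ) (γ : ℝ → M), γ 0 = x → IsMIntegralCurveOn γ V (Ico 0 T) →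
      ∀ t ∈ Ico 0 T, γ t ∈ W

/-- Every forward solution that starts close enough to `z` converges to `z`. -/
def IsLocallyAttracting (V : ∀ x : M, TangentSpace 𝓘(ℝ, E) x) (z : M) : Prop :=
  ∃ O ∈ 𝓝 z, ∀ γ : ℝ → M, γ 0 ∈ O → IsMIntegralCurveOn γ V (Ici 0) → Tendsto γ atTop (𝓝 z)

/-- There is a neighbourhood `W` of `z` such that arbitrarily close to `z` there start solutions
that leave `W` in finite time. -/
def IsUnstable (V : ∀ x : M, TangentSpace 𝓘(ℝ, E) x) (z : M) : Prop :=
  ∃ W ∈ 𝓝 z, ∀ O ∈ 𝓝 z, ∃ γ : ℝ → M, ∃ T : ℝ,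
    0 ≤ T ∧ γ 0 ∈ O ∧ IsMIntegralCurveOn γ V (Icc 0 T) ∧ γ T ∉ W

end Riemannian

/-- Inputs `x ∈ ℝ^d`. -/
abbrev Input (d : ℕ) : Type := EuclideanSpace ℝ (Fin d)

/-- Vectors of outputs on a sample of size `n`, with the Euclidean inner product. -/
abbrev Output (n : ℕ) : Type := EuclideanSpace ℝ (Fin n)

/-- Parameters `θ = ((a_1, w_1), …, (a_m, w_m))`. -/
abbrev Param (m d : ℕ) : Type := Fin m → ℝ × EuclideanSpace ℝ (Fin d)

/-- `f_θ(x) = ∑ a_i σ(⟨w_i, x⟩)`. -/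
def network {m d : ℕ} (σ : ℝ → ℝ) (θ : Param m d) (x : Input d) : ℝ :=
  ∑ i, (θ i).1 * σ (inner ℝ (θ i).2 x)

/-- The finite-sample realization map `Φ_X(θ) = (f_θ(x_1), …, f_θ(x_n))`. -/
def realization {m d n : ℕ} (σ : ℝ → ℝ) (X : Fin n → Input d) (θ : Param m d) : Output n :=
  WithLp.toLp 2 fun k => network σ θ (X k)

/-- The multiplicative group of positive reals. -/
abbrev PosReal : Type := {c : ℝ // 0 < c}

/-- The symmetry group `(ℝ_{>0})^m ⋊ S_m`, where permutations permute the coordinates. -/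
abbrev SymGroup (m : ℕ) : Type :=
  (Fin m → PosReal) ⋊[mulAutArrow] Equiv.Perm (Fin m)

/-- The Lie group topology: the product topology, with `S_m` discrete. -/
instance symGroupTopology (m : ℕ) : TopologicalSpace (SymGroup m) :=
  TopologicalSpace.induced (fun g => g.left) inferInstance ⊓
    TopologicalSpace.induced (fun g => g.right) ⊥

/-- Permutation of the neurons (`π` moves neuron `j` to place `π j`) followed by neuronwise rescaling
`(a_i, w_i) ↦ (c_i^{-p} a_i, c_i w_i)`. -/
def act {m d : ℕ} (p : ℝ) (g : SymGroup m) (θ : Param m d) : Param m d := fun i =>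
  ((g.left i : ℝ) ^ (-p) * (θ (g.right⁻¹ i)).1, (g.left i : ℝ) • (θ (g.right⁻¹ i)).2)

/-- The infinitesimal scaling `δ_ξ θ = ((-p ξ_1 a_1, ξ_1 w_1), …, (-p ξ_m a_m, ξ_m w_m))`. -/
def infAct {m d : ℕ} (p : ℝ) (θ : Param m d) : (Fin m → ℝ) →ₗ[ℝ] Param m d where
  toFun ξ := fun i => (-p * ξ i * (θ i).1, ξ i • (θ i).2)
  map_add' ξ η := by
    funext i
    refine Prod.ext ?_ ?_
    · simp; ring
    · simp [add_smul]
  map_smul' c ξ := by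
    funext i
    refine Prod.ext ?_ ?_
    · simp; ring
    · simp [mul_smul]

/-- The tangent space `T_θ(G·θ)` of the orbit. -/
def orbitTangent {m d : ℕ} (p : ℝ) (θ : Param m d) : Submodule ℝ (Param m d) :=
  LinearMap.range (infAct p θ)

theorem act_one {m d : ℕ} (p : ℝ) (θ : Param m d) : act p 1 θ = θ := by
  funext i
  simp [act]

theorem act_mul {m d : ℕ} (p : ℝ) (g h : SymGroup m) (θ : Param m d) :
    act p (g * h) θ = act p g (act p h θ) := by
  funext i
  have h1 : (((g * h).left i : PosReal) : ℝ) = (g.left i : ℝ) * (h.left (g.right⁻¹ i) : ℝ) := by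
    rfl
  have h2 : (g * h).right⁻¹ i = h.right⁻¹ (g.right⁻¹ i) := by
    simp [SemidirectProduct.mul_right]
  have hg := (g.left i).2
  have hh := (h.left (g.right⁻¹ i)).2
  simp only [act, h1, h2]
  refine Prod.ext ?_ ?_
  · simp only [Real.mul_rpow hg.le hh.le]; ring
  · simp only [mul_smul]

theorem network_act {m d : ℕ} {σ : ℝ → ℝ} {p : ℝ}
    (hσ : ∀ c t : ℝ, 0 < c → σ (c * t) = c ^ p * σ t) (g : SymGroup m) (θ : Param m d)
    (x : Input d) : network σ (act p g θ) x = network σ θ x := by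
  unfold network act
  rw [← Equiv.sum_comp g.right]
  refine Finset.sum_congr rfl fun i _ => ?_
  have hc := (g.left (g.right i)).2
  have hi : g.right⁻¹ (g.right i) = i := g.right.symm_apply_apply i
  simp only [hi, inner_smul_left, conj_trivial]
  rw [hσ _ _ hc, Real.rpow_neg hc.le]
  have : ((g.left (g.right i) : ℝ) ^ p) ≠ 0 := (Real.rpow_pos_of_pos hc p).ne'
  field_simp

/-- A shallow network with a positively `p`-homogeneous activation `σ`, a sample `X`, and a regular set
of parameters: an open `G`-invariant set `reg` on which the realization map `Φ_X` is smooth, the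
action of `G` is locally free and proper, and `ker DΦ_X(θ) = T_θ(G·θ)`. -/
structure RegularModel (m d n : ℕ) where
  σ : ℝ → ℝ
  p : ℝ
  p_pos : 0 < p
  homogeneous : ∀ c t : ℝ, 0 < c → σ (c * t) = c ^ p * σ t
  X : Fin n → Input d
  reg : Set (Param m d)
  isOpen_reg : IsOpen reg
  invariant : ∀ g : SymGroup m, ∀ θ ∈ reg, act p g θ ∈ reg
  smooth : ContDiffOn ℝ ∞ (realization σ X) reg
  locallyFree : ∀ θ ∈ reg, ∃ N ∈ 𝓝 (1 : SymGroup m), ∀ g ∈ N, act p g θ = θ → g = 1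
  ker_eq : ∀ θ ∈ reg, (fderiv ℝ (realization σ X) θ).ker = orbitTangent p θ
  proper : IsProperMap fun gθ : SymGroup m × reg =>
    ((⟨act p gθ.1 gθ.2, invariant gθ.1 gθ.2 gθ.2.2⟩ : reg), gθ.2)

variable {m d n : ℕ}

namespace RegularModel

/-- The regular set as an open submanifold of the parameter space. -/
def Reg (S : RegularModel m d n) : TopologicalSpace.Opens (Param m d) := ⟨S.reg, S.isOpen_reg⟩

/-- The realization map `Φ_X`. -/
def phi (S : RegularModel m d n) (θ : Param m d) : Output n := realization S.σ S.X θ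

instance regMulAction (S : RegularModel m d n) : MulAction (SymGroup m) S.Reg where
  smul g θ := ⟨act S.p g θ, S.invariant g θ θ.2⟩
  one_smul _ := Subtype.ext (act_one S.p _)
  mul_smul g h _ := Subtype.ext (act_mul S.p g h _)

instance regProperSMul (S : RegularModel m d n) : ProperSMul (SymGroup m) S.Reg :=
  ⟨S.proper⟩

/-- The quotient `Θ_reg / G`, with the quotient topology and the smooth structure below. -/
def Mreg (S : RegularModel m d n) : Type := MulAction.orbitRel.Quotient (SymGroup m) S.Reg

instance mregTopology (S : RegularModel m d n) : TopologicalSpace S.Mreg :=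
  inferInstanceAs (TopologicalSpace (Quotient (MulAction.orbitRel (SymGroup m) S.Reg)))

instance mregT2 (S : RegularModel m d n) : T2Space S.Mreg :=
  inferInstanceAs (T2Space (Quotient (MulAction.orbitRel (SymGroup m) S.Reg)))

/-- The quotient map. -/
def q (S : RegularModel m d n) (θ : S.Reg) : S.Mreg :=
  Quotient.mk (MulAction.orbitRel (SymGroup m) S.Reg) θ

theorem phi_act (S : RegularModel m d n) (g : SymGroup m) (θ : Param m d) :
    S.phi (act S.p g θ) = S.phi θ := by
  simp only [phi, realization, network_act S.homogeneous]

theorem q_smul (S : RegularModel m d n) (g : SymGroup m) (θ : S.Reg) : S.q (g • θ) = S.q θ :=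
  Quotient.sound ⟨g, rfl⟩

theorem q_eq_iff (S : RegularModel m d n) {θ θ' : S.Reg} :
    S.q θ = S.q θ' ↔ ∃ g : SymGroup m, g • θ' = θ :=
  Quotient.eq.trans MulAction.orbitRel_apply

theorem q_surjective (S : RegularModel m d n) : Function.Surjective S.q := Quotient.mk_surjective

theorem continuous_q (S : RegularModel m d n) : Continuous S.q := continuous_quotient_mk'

theorem isOpenMap_q (S : RegularModel m d n) : IsOpenMap S.q :=
  MulAction.isOpenQuotientMap_quotientMk.isOpenMap

/-- The map on the quotient with `descend F [θ] = F (Φ_X(θ))`. -/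
def descend (S : RegularModel m d n) {α : Type*} (F : Output n → α) : S.Mreg → α :=
  Quotient.lift (fun θ : S.Reg => F (S.phi θ)) (by
    rintro a b h
    obtain ⟨g, rfl⟩ := MulAction.orbitRel_apply.1 h
    exact congrArg F (S.phi_act g b))

theorem descend_q (S : RegularModel m d n) {α : Type*} (F : Output n → α) (θ : S.Reg) :
    S.descend F (S.q θ) = F (S.phi θ) := rfl


theorem infAct_injective (S : RegularModel m d n) {θ : Param m d} (hθ : θ ∈ S.reg) :
    Function.Injective (infAct S.p θ) := by
  rw [← LinearMap.ker_eq_bot, LinearMap.ker_eq_bot']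
  intro ξ hξ
  by_contra hne
  obtain ⟨i, hi⟩ := Function.ne_iff.1 hne
  have h1 := congrFun hξ i
  have h2 : -S.p * ξ i * (θ i).1 = 0 := congrArg Prod.fst h1
  have h3 : ξ i • (θ i).2 = 0 := congrArg Prod.snd h1
  have hi' : ξ i ≠ 0 := hi
  have ha : (θ i).1 = 0 := by
    rcases mul_eq_zero.1 h2 with h | h
    · rcases mul_eq_zero.1 h with h | h
      · exact absurd (neg_eq_zero.1 h) S.p_pos.ne'
      · exact absurd h hi'
    · exact h
  have hw : (θ i).2 = 0 := (smul_eq_zero.1 h3).resolve_left hi'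
  obtain ⟨N, hN, hfree⟩ := S.locallyFree θ hθ
  let c : ℝ → SymGroup m := fun t => ⟨Function.update 1 i ⟨Real.exp t, Real.exp_pos t⟩, 1⟩
  have hc0 : c 0 = 1 := by
    refine SemidirectProduct.ext ?_ rfl
    change Function.update (1 : Fin m → PosReal) i _ = 1
    rw [Function.update_eq_iff]
    refine ⟨Subtype.ext ?_, fun _ _ => rfl⟩
    simp
  have hcont : Continuous c := by
    refine continuous_inf_rng.2 ⟨continuous_induced_rng.2 ?_, continuous_induced_rng.2 ?_⟩
    · change Continuous fun t => Function.update (1 : Fin m → PosReal) i ⟨Real.exp t, Real.exp_pos t⟩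
      exact continuous_const.update i (Real.continuous_exp.subtype_mk _)
    · exact @continuous_const _ _ _ ⊥ _
  have hev : ∀ᶠ t in 𝓝 (0 : ℝ), c t ∈ N := hcont.continuousAt.eventually (by rw [hc0]; exact hN)
  have hfix : ∀ t, act S.p (c t) θ = θ := by
    intro t
    funext j
    by_cases hj : j = i
    · subst hj
      refine Prod.ext ?_ ?_
      · simp [act, c, ha]
      · simp [act, c, hw]
    · simp [act, c, Function.update_of_ne hj]
  obtain ⟨t, ht, htne⟩ := ((hev.filter_mono nhdsWithin_le_nhds).and
    (self_mem_nhdsWithin : ∀ᶠ t in 𝓝[≠] (0 : ℝ), t ∈ ({0}ᶜ : Set ℝ))).exists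
  have h4 : c t = 1 := hfree _ ht (hfix t)
  have h5 := congrFun (congrArg SemidirectProduct.left h4) i
  have h6 : Real.exp t = 1 := by
    have := congrArg Subtype.val h5
    simpa [c] using this
  exact htne (by simpa using h6)

theorem finrank_ker (S : RegularModel m d n) {θ : Param m d} (hθ : θ ∈ S.reg) :
    Module.finrank ℝ (fderiv ℝ S.phi θ).ker = m := by
  have h := S.ker_eq θ hθ
  change (fderiv ℝ S.phi θ).ker = _ at h
  rw [h]
  unfold orbitTangent
  rw [LinearMap.finrank_range_of_inj (S.infAct_injective hθ)]
  simp

theorem finrank_range (S : RegularModel m d n) {θ : Param m d} (hθ : θ ∈ S.reg) :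
    Module.finrank ℝ (fderiv ℝ S.phi θ).range = m * d := by
  have h1 := LinearMap.finrank_range_add_finrank_ker (fderiv ℝ S.phi θ).toLinearMap
  have h2 := S.finrank_ker hθ
  have h3 : Module.finrank ℝ (Param m d) = m * (1 + d) := by
    simp [Module.finrank_pi_fintype]
  have h4 : m * (1 + d) = m * d + m := by ring
  change Module.finrank ℝ (fderiv ℝ S.phi θ).toLinearMap.range = m * d
  change Module.finrank ℝ (fderiv ℝ S.phi θ).toLinearMap.ker = m at h2
  omega

theorem contDiffAt_phi (S : RegularModel m d n) {θ : Param m d} (hθ : θ ∈ S.reg) :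
    ContDiffAt ℝ ∞ S.phi θ :=
  (S.smooth θ hθ).contDiffAt (S.isOpen_reg.mem_nhds hθ)

/-- The model space of the quotient manifold, of dimension `m(d+1) - m`. -/
abbrev Model (m d : ℕ) : Type := EuclideanSpace ℝ (Fin (m * d))

/-- An affine slice `y ↦ θ₀ + incl y` through `θ₀`, transverse to the orbits, with a local
coordinate `homeo y = proj (Φ_X (θ₀ + incl y))` on it. It yields a chart of the quotient. -/
structure Slice (S : RegularModel m d n) (θ₀ : S.Reg) where
  incl : Model m d →L[ℝ] Param m d
  proj : Output n →L[ℝ] Model m d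
  homeo : OpenPartialHomeomorph (Model m d) (Model m d)
  zero_mem : (0 : Model m d) ∈ homeo.source
  mem_reg : ∀ y ∈ homeo.source, (θ₀ : Param m d) + incl y ∈ S.reg
  homeo_apply : ∀ y ∈ homeo.source, homeo y = proj (S.phi (θ₀ + incl y))
  inj : ∀ y ∈ homeo.source, ∀ v : Model m d,
    fderiv ℝ S.phi ((θ₀ : Param m d) + incl y) (incl v) = 0 → v = 0
  contDiffOn_symm : ContDiffOn ℝ ∞ homeo.symm homeo.target

theorem nonempty_slice (S : RegularModel m d n) (θ₀ : S.Reg) : Nonempty (S.Slice θ₀) := by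
  have hθ₀ : (θ₀ : Param m d) ∈ S.reg := θ₀.2
  set A : Param m d →ₗ[ℝ] Output n := (fderiv ℝ S.phi θ₀).toLinearMap with hA
  have hfr : Module.finrank ℝ (Model m d) = Module.finrank ℝ A.range := by
    have := S.finrank_range hθ₀
    change Module.finrank ℝ A.range = m * d at this
    rw [this]; simp
  let e : Model m d ≃ₗ[ℝ] A.range := LinearEquiv.ofFinrankEq _ _ hfr
  obtain ⟨R, hR⟩ := A.rangeRestrict.exists_rightInverse_of_surjective (LinearMap.range_rangeRestrict A)
  obtain ⟨Q, hQ⟩ := A.range.subtype.exists_leftInverse_of_injective (Submodule.ker_subtype _)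
  let incl : Model m d →L[ℝ] Param m d := (R ∘ₗ e.toLinearMap).toContinuousLinearMap
  let proj : Output n →L[ℝ] Model m d := (e.symm.toLinearMap ∘ₗ Q).toContinuousLinearMap
  have hPA : ∀ y, proj (fderiv ℝ S.phi θ₀ (incl y)) = y := by
    intro y
    have h1 : fderiv ℝ S.phi θ₀ (incl y) = A.range.subtype (e y) := by
      have h2 := LinearMap.congr_fun hR (e y)
      exact congrArg Subtype.val h2
    have h3 : Q (A.range.subtype (e y)) = e y := LinearMap.congr_fun hQ (e y)
    change e.symm (Q (fderiv ℝ S.phi θ₀ (incl y))) = y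
    rw [h1, h3]; simp
  let sl : Model m d → Param m d := fun y => θ₀ + incl y
  have hsl : ContDiff ℝ ∞ sl := contDiff_const.add incl.contDiff
  let k : Model m d → Model m d := fun y => proj (S.phi (sl y))
  let D₀ : Set (Model m d) := sl ⁻¹' S.reg
  have hD₀ : IsOpen D₀ := S.isOpen_reg.preimage hsl.continuous
  have hsl0 : sl 0 = θ₀ := by simp [sl]
  have h0 : (0 : Model m d) ∈ D₀ := by
    change sl 0 ∈ S.reg
    rw [hsl0]; exact hθ₀
  have hk : ContDiffOn ℝ ∞ k D₀ := by
    refine proj.contDiff.comp_contDiffOn ?_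
    exact S.smooth.comp hsl.contDiffOn (fun y hy => hy)
  have hkd : ∀ y ∈ D₀, HasFDerivAt k (proj ∘L (fderiv ℝ S.phi (sl y) ∘L incl)) y := by
    intro y hy
    have h1 : HasFDerivAt sl incl y := incl.hasFDerivAt.const_add _
    have h2 : HasFDerivAt S.phi (fderiv ℝ S.phi (sl y)) (sl y) :=
      ((S.contDiffAt_phi hy).differentiableAt (by simp)).hasFDerivAt
    exact proj.hasFDerivAt.comp y (h2.comp y h1)
  have hk0 : HasFDerivAt k ((ContinuousLinearEquiv.refl ℝ (Model m d) :
      Model m d ≃L[ℝ] Model m d) : Model m d →L[ℝ] Model m d) 0 := by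
    have h1 := hkd 0 h0
    rw [hsl0] at h1
    convert! h1 using 1
    ext1 y
    exact (hPA y).symm
  have hkc : ContDiffAt ℝ ∞ k 0 := hk.contDiffAt (hD₀.mem_nhds h0)
  let U : Set (Model m d →L[ℝ] Model m d) :=
    range ((↑) : (Model m d ≃L[ℝ] Model m d) → Model m d →L[ℝ] Model m d)
  have hU : IsOpen U := ContinuousLinearEquiv.isOpen
  let D : Set (Model m d) := D₀ ∩ fderiv ℝ k ⁻¹' U
  have hD : IsOpen D :=
    (hk.continuousOn_fderiv_of_isOpen hD₀ (by simp)).isOpen_inter_preimage hD₀ hU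
  let K₀ := hkc.toOpenPartialHomeomorph k hk0 (by simp)
  let K := K₀.restrOpen D hD
  have hKs : ∀ y ∈ K.source, y ∈ D := fun y hy => by
    have : y ∈ K₀.source ∩ D := by simpa [K] using hy
    exact this.2
  have hKk : ∀ y, K y = k y := fun y => rfl
  refine ⟨⟨incl, proj, K, ?_, fun y hy => (hKs y hy).1, fun y _ => rfl, ?_, ?_⟩⟩
  · have : (0 : Model m d) ∈ K₀.source ∩ D := by
      refine ⟨hkc.mem_toOpenPartialHomeomorph_source hk0 (by simp), h0, ?_⟩
      change fderiv ℝ k 0 ∈ U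
      rw [hk0.fderiv]
      exact ⟨_, rfl⟩
    simpa [K] using this
  · intro y hy v hv
    obtain ⟨hy0, E, hE⟩ := hKs y hy
    rw [(hkd y hy0).fderiv] at hE
    have h1 : E v = 0 := by
      have := DFunLike.congr_fun hE v
      change E v = proj (fderiv ℝ S.phi (sl y) (incl v)) at this
      rw [this]
      change proj (fderiv ℝ S.phi ((θ₀ : Param m d) + incl y) (incl v)) = 0
      rw [hv, map_zero]
    exact E.map_eq_zero_iff.1 h1
  · intro z hz
    have hy : K.symm z ∈ K.source := K.map_target hz
    obtain ⟨hy0, E, hE⟩ := hKs _ hy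
    have hd := (hk.contDiffAt (hD₀.mem_nhds hy0)).differentiableAt (by simp)
    refine (K.contDiffAt_symm hz (f₀' := E) ?_ (hk.contDiffAt (hD₀.mem_nhds hy0))).contDiffWithinAt
    rw [hE]
    exact hd.hasFDerivAt

/-- A choice of a slice through each regular point. -/
def slice (S : RegularModel m d n) (θ₀ : S.Reg) : S.Slice θ₀ := (S.nonempty_slice θ₀).some

namespace Slice

variable {S : RegularModel m d n} {θ₀ : S.Reg} (c : S.Slice θ₀)

theorem map_nhds {y : Model m d} (hy : y ∈ c.homeo.source) :
    ∃ T : (Fin m → ℝ) × Model m d → Param m d,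
      (∀ z, ∃ g : SymGroup m, T z = act S.p g ((θ₀ : Param m d) + c.incl z.2)) ∧
      map T (𝓝 (0, y)) = 𝓝 ((θ₀ : Param m d) + c.incl y) := by
  let sl : Model m d → Param m d := fun y => θ₀ + c.incl y
  let T : (Fin m → ℝ) × Model m d → Param m d := fun z i =>
    (Real.exp (-S.p * z.1 i) * (sl z.2 i).1, Real.exp (z.1 i) • (sl z.2 i).2)
  have hT0 : T (0, y) = sl y := by
    funext i
    simp [T]
  refine ⟨T, fun z => ⟨⟨fun i => ⟨Real.exp (z.1 i), Real.exp_pos _⟩, 1⟩, ?_⟩, ?_⟩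
  · funext i
    simp only [T, act, sl]
    rw [← Real.exp_mul]
    simp [mul_comm]
  have hTc : ContDiff ℝ ∞ T := by
    rw [contDiff_pi]
    intro i
    have h1 : ContDiff ℝ ∞ fun z : (Fin m → ℝ) × Model m d => sl z.2 i := by
      have : ContDiff ℝ ∞ fun z : (Fin m → ℝ) × Model m d => sl z.2 :=
        contDiff_const.add (c.incl.contDiff.comp contDiff_snd)
      exact contDiff_pi.1 this i
    have h2 : ContDiff ℝ ∞ fun z : (Fin m → ℝ) × Model m d => z.1 i :=
      contDiff_pi.1 contDiff_fst i
    exact ((Real.contDiff_exp.comp (contDiff_const.mul h2)).mul h1.fst).prodMk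
      ((Real.contDiff_exp.comp h2).smul h1.snd)
  have hst : HasStrictFDerivAt T (fderiv ℝ T (0, y)) (0, y) :=
    hTc.contDiffAt.hasStrictFDerivAt (by simp)
  have hd : HasFDerivAt T (fderiv ℝ T (0, y)) (0, y) := hst.hasFDerivAt
  have e1 : ∀ v, fderiv ℝ T (0, y) (0, v) = c.incl v := by
    intro v
    have h1 : HasFDerivAt (fun y' : Model m d => ((0 : Fin m → ℝ), y'))
        (ContinuousLinearMap.inr ℝ (Fin m → ℝ) (Model m d)) y := hasFDerivAt_prodMk_right _ _
    have h2 := HasFDerivAt.comp y hd h1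
    have h3 : T ∘ (fun y' : Model m d => ((0 : Fin m → ℝ), y')) = sl := by
      funext y' i
      simp [T]
    rw [h3] at h2
    have h4 : HasFDerivAt sl c.incl y := c.incl.hasFDerivAt.const_add _
    exact DFunLike.congr_fun (h2.unique h4) v
  have e2 : ∀ ξ, fderiv ℝ T (0, y) (ξ, 0) = infAct S.p (sl y) ξ := by
    intro ξ
    have h1 : HasDerivAt (fun t : ℝ => (t • ξ, y)) (ξ, (0 : Model m d)) 0 := by
      have : HasDerivAt (fun t : ℝ => t • ξ) ξ 0 := by
        simpa using (hasDerivAt_id (0 : ℝ)).smul_const ξ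
      exact this.prodMk (hasDerivAt_const _ _)
    have hd' : HasFDerivAt T (fderiv ℝ T (0, y)) ((fun t : ℝ => (t • ξ, y)) 0) := by
      simpa using hd
    have h2 := hd'.comp_hasDerivAt (0 : ℝ) h1
    have h3 : HasDerivAt (T ∘ fun t : ℝ => (t • ξ, y)) (infAct S.p (sl y) ξ) 0 := by
      rw [hasDerivAt_pi]
      intro i
      have hi : HasDerivAt (fun t : ℝ => t * ξ i) (ξ i) 0 := by
        simpa using (hasDerivAt_id (0 : ℝ)).mul_const (ξ i)
      have ha : HasDerivAt (fun t : ℝ => Real.exp (-S.p * (t * ξ i)) * (sl y i).1)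
          (-S.p * ξ i * (sl y i).1) 0 := by
        simpa using ((hi.const_mul (-S.p)).exp).mul_const (sl y i).1
      have hw : HasDerivAt (fun t : ℝ => Real.exp (t * ξ i) • (sl y i).2)
          (ξ i • (sl y i).2) 0 := by
        simpa using (hi.exp).smul_const (sl y i).2
      exact ha.prodMk hw
    exact h2.unique h3
  have hreg : sl y ∈ S.reg := c.mem_reg y hy
  have hinj : Function.Injective (fderiv ℝ T (0, y)) := by
    rw [injective_iff_map_eq_zero]
    rintro ⟨ξ, v⟩ h
    have h1 : ((ξ, v) : (Fin m → ℝ) × Model m d) = (ξ, 0) + (0, v) := by simp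
    rw [h1, map_add, e1, e2] at h
    have h2 : fderiv ℝ S.phi (sl y) (infAct S.p (sl y) ξ) = 0 := by
      have : infAct S.p (sl y) ξ ∈ (fderiv ℝ S.phi (sl y)).ker := by
        have hk := S.ker_eq _ hreg
        change (fderiv ℝ S.phi (sl y)).ker = _ at hk
        rw [hk]
        exact ⟨ξ, rfl⟩
      exact this
    have h3 : fderiv ℝ S.phi (sl y) (c.incl v) = 0 := by
      have := congrArg (fderiv ℝ S.phi (sl y)) h
      rwa [map_add, h2, zero_add, map_zero] at this
    have hv : v = 0 := c.inj y hy v h3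
    subst hv
    have h4 : infAct S.p (sl y) ξ = 0 := by simpa using h
    have hξ : ξ = 0 := S.infAct_injective hreg (by rw [h4, map_zero])
    subst hξ
    rfl
  have hsurj : (fderiv ℝ T (0, y)).range = ⊤ := by
    have hdim : Module.finrank ℝ ((Fin m → ℝ) × Model m d) = Module.finrank ℝ (Param m d) := by
      simp [Module.finrank_pi_fintype]
      ring
    exact LinearMap.range_eq_top.2 ((LinearMap.injective_iff_surjective_of_finrank_eq_finrank hdim
      (f := (fderiv ℝ T (0, y)).toLinearMap)).1 hinj)
  rw [hst.map_nhds_eq_of_surj hsurj, hT0]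

/-- The orbit of the point `θ₀ + incl y` of the slice. -/
def point (y : Model m d) : S.Mreg :=
  haveI := Classical.dec ((θ₀ : Param m d) + c.incl y ∈ S.reg)
  if h : (θ₀ : Param m d) + c.incl y ∈ S.reg then S.q ⟨_, h⟩ else S.q θ₀

theorem point_eq {y : Model m d} (h : (θ₀ : Param m d) + c.incl y ∈ S.reg) :
    c.point y = S.q ⟨_, h⟩ := dif_pos h

theorem proj_point {y : Model m d} (hy : y ∈ c.homeo.source) :
    S.descend c.proj (c.point y) = c.homeo y := by
  rw [c.point_eq (c.mem_reg y hy), S.descend_q, c.homeo_apply y hy]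

theorem isOpen_image : IsOpen (c.point '' c.homeo.source) := by
  rw [isOpen_iff_mem_nhds]
  rintro _ ⟨y, hy, rfl⟩
  obtain ⟨T, hT, hmap⟩ := c.map_nhds hy
  have hreg := c.mem_reg y hy
  rw [c.point_eq hreg]
  have h1 : T '' (Prod.snd ⁻¹' c.homeo.source) ∈ 𝓝 ((θ₀ : Param m d) + c.incl y) := by
    rw [← hmap]
    exact image_mem_map ((c.homeo.open_source.preimage continuous_snd).mem_nhds hy)
  have h2 : (Subtype.val ⁻¹' (T '' (Prod.snd ⁻¹' c.homeo.source)) : Set S.Reg) ∈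
      𝓝 (⟨_, hreg⟩ : S.Reg) := continuousAt_subtype_val.preimage_mem_nhds h1
  refine mem_of_superset (S.isOpenMap_q.image_mem_nhds h2) ?_
  rintro _ ⟨θ, ⟨z, hz, hzθ⟩, rfl⟩
  obtain ⟨g, hg⟩ := hT z
  refine ⟨z.2, hz, ?_⟩
  rw [c.point_eq (c.mem_reg _ hz), ← S.q_smul g]
  congr 1
  exact Subtype.ext (hg.symm.trans hzθ)

theorem continuous_descend_proj : Continuous (S.descend c.proj) := by
  refine continuous_quot_lift _ ?_
  refine c.proj.continuous.comp (continuous_iff_continuousAt.2 fun θ => ?_)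
  exact (S.contDiffAt_phi θ.2).continuousAt.comp continuousAt_subtype_val

theorem continuousOn_point : ContinuousOn c.point c.homeo.source := by
  rw [continuousOn_iff_continuous_domRestrict]
  have h : Continuous fun y : c.homeo.source => S.q ⟨_, c.mem_reg y y.2⟩ :=
    S.continuous_q.comp ((continuous_const.add
      (c.incl.continuous.comp continuous_subtype_val)).subtype_mk _)
  refine h.congr fun y => ?_
  exact (c.point_eq _).symm

/-- The chart of the quotient given by a slice. -/
def chart : OpenPartialHomeomorph S.Mreg (Model m d) where
  toFun := S.descend c.proj
  invFun z := c.point (c.homeo.symm z)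
  source := c.point '' c.homeo.source
  target := c.homeo.target
  map_source' := by
    rintro _ ⟨y, hy, rfl⟩
    rw [c.proj_point hy]
    exact c.homeo.map_source hy
  map_target' z hz := ⟨_, c.homeo.map_target hz, rfl⟩
  left_inv' := by
    rintro _ ⟨y, hy, rfl⟩
    rw [c.proj_point hy, c.homeo.left_inv hy]
  right_inv' z hz := by
    rw [c.proj_point (c.homeo.map_target hz), c.homeo.right_inv hz]
  open_source := c.isOpen_image
  open_target := c.homeo.open_target
  continuousOn_toFun := c.continuous_descend_proj.continuousOn
  continuousOn_invFun := c.continuousOn_point.comp c.homeo.continuousOn_symm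
    fun z hz => c.homeo.map_target hz

theorem mem_chart_source : S.q θ₀ ∈ c.chart.source := by
  refine ⟨0, c.zero_mem, ?_⟩
  rw [c.point_eq (c.mem_reg 0 c.zero_mem)]
  congr 1
  exact Subtype.ext (by simp)

theorem contDiffOn_phi_symm : ContDiffOn ℝ ∞
    (fun z => S.descend id (c.chart.symm z)) c.chart.target := by
  have h : ContDiffOn ℝ ∞ (fun z => S.phi (θ₀ + c.incl (c.homeo.symm z))) c.homeo.target :=
    S.smooth.comp (contDiffOn_const.add (c.incl.contDiff.comp_contDiffOn c.contDiffOn_symm))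
      fun z hz => c.mem_reg _ (c.homeo.map_target hz)
  refine h.congr fun z hz => ?_
  change S.descend id (c.point (c.homeo.symm z)) = _
  rw [c.point_eq (c.mem_reg _ (c.homeo.map_target hz)), S.descend_q]
  rfl

end Slice

/-- The smooth structure of the quotient manifold: by `mregIsManifold`, `contMDiff_q` and
`dq_surjective` it is a smooth structure for which the quotient map is a submersion. -/
instance mregChartedSpace (S : RegularModel m d n) : ChartedSpace (Model m d) S.Mreg where
  atlas := range fun θ : S.Reg => (S.slice θ).chart
  chartAt x := (S.slice (Quotient.out x)).chart
  mem_chart_source x := by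
    have h := (S.slice (Quotient.out x)).mem_chart_source
    have hx : S.q (Quotient.out x) = x := Quotient.out_eq x
    rwa [hx] at h
  chart_mem_atlas x := ⟨_, rfl⟩

theorem descend_eq (S : RegularModel m d n) {α : Type*} (F : Output n → α) (x : S.Mreg) :
    S.descend F x = F (S.descend id x) := by
  obtain ⟨θ, rfl⟩ := S.q_surjective x
  rfl

instance mregIsManifold (S : RegularModel m d n) :
    IsManifold 𝓘(ℝ, Model m d) ∞ S.Mreg := by
  refine isManifold_of_contDiffOn _ _ _ ?_
  rintro _ _ ⟨θ₁, rfl⟩ ⟨θ₂, rfl⟩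
  have h := (S.slice θ₂).proj.contDiff.comp_contDiffOn (S.slice θ₁).contDiffOn_phi_symm
  simp only [modelWithCornersSelf_coe, modelWithCornersSelf_coe_symm, Function.comp_id,
    Function.id_comp, range_id, inter_univ, preimage_id]
  refine (h.mono ?_).congr fun z _ => ?_
  · exact fun z hz => hz.1
  · exact S.descend_eq _ _


theorem contMDiff_q (S : RegularModel m d n) :
    ContMDiff 𝓘(ℝ, Param m d) 𝓘(ℝ, Model m d) ∞ S.q := by
  intro θ
  rw [contMDiffAt_iff_target]
  refine ⟨S.continuous_q.continuousAt, ?_⟩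
  have h : ContMDiffAt 𝓘(ℝ, Param m d) 𝓘(ℝ, Model m d) ∞
      (fun θ' : S.Reg => (S.slice (Quotient.out (S.q θ))).proj (S.phi θ')) θ := by
    have h1 : ContMDiffAt 𝓘(ℝ, Param m d) 𝓘(ℝ, Output n) ∞ S.phi (θ : Param m d) :=
      (S.contDiffAt_phi θ.2).contMDiffAt
    have h2 : ContMDiffAt 𝓘(ℝ, Param m d) 𝓘(ℝ, Param m d) ∞
        (Subtype.val : S.Reg → Param m d) θ := contMDiff_subtype_val θ
    exact (S.slice (Quotient.out (S.q θ))).proj.contMDiff.contMDiffAt.comp θ (h1.comp θ h2)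
  exact h

theorem hasMFDerivAt_regVal (S : RegularModel m d n) (θ : S.Reg) :
    HasMFDerivAt 𝓘(ℝ, Param m d) 𝓘(ℝ, Param m d) (Subtype.val : S.Reg → Param m d) θ
      (ContinuousLinearMap.id ℝ (Param m d)) := by
  refine ⟨continuousAt_subtype_val, ?_⟩
  have h1 : (fun y : Param m d => y) =ᶠ[𝓝 (extChartAt 𝓘(ℝ, Param m d) θ θ)]
      writtenInExtChartAt 𝓘(ℝ, Param m d) 𝓘(ℝ, Param m d) θ (Subtype.val : S.Reg → Param m d) := by
    filter_upwards [extChartAt_target_mem_nhds (I := 𝓘(ℝ, Param m d)) θ] with y hy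
    exact ((extChartAt 𝓘(ℝ, Param m d) θ).right_inv hy).symm
  exact ((hasFDerivAt_id (𝕜 := ℝ) _).congr_of_eventuallyEq h1.symm).hasFDerivWithinAt

/-- The differential `DΦ_X(θ)`. -/
def dphi (S : RegularModel m d n) (θ : Param m d) : Param m d →L[ℝ] Output n :=
  fderiv ℝ S.phi θ

theorem hasMFDerivAt_phi (S : RegularModel m d n) (θ : S.Reg) :
    HasMFDerivAt 𝓘(ℝ, Param m d) 𝓘(ℝ, Output n) (fun θ' : S.Reg => S.phi θ') θ
      (S.dphi θ) := by
  have h1 : HasMFDerivAt 𝓘(ℝ, Param m d) 𝓘(ℝ, Output n) S.phi (θ : Param m d)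
      (S.dphi θ) :=
    ((S.contDiffAt_phi θ.2).differentiableAt (by simp)).hasFDerivAt.hasMFDerivAt
  exact h1.comp θ (S.hasMFDerivAt_regVal θ)

theorem contMDiff_descend (S : RegularModel m d n) {F : Type*} [NormedAddCommGroup F]
    [NormedSpace ℝ F] {f : Output n → F} (hf : ContDiff ℝ ∞ f) :
    ContMDiff 𝓘(ℝ, Model m d) 𝓘(ℝ, F) ∞ (S.descend f) := by
  intro x
  let c := S.slice (Quotient.out x)
  have hx : x ∈ c.chart.source := mem_chart_source (Model m d) x
  have h1 : ContMDiffAt 𝓘(ℝ, Model m d) 𝓘(ℝ, F) ∞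
      (fun z => f (S.descend id (c.chart.symm z))) (c.chart x) :=
    (hf.contDiffAt.comp _ ((c.contDiffOn_phi_symm).contDiffAt
      (c.chart.open_target.mem_nhds (c.chart.map_source hx)))).contMDiffAt
  have h2 : ContMDiffAt 𝓘(ℝ, Model m d) 𝓘(ℝ, Model m d) ∞ c.chart x :=
    contMDiffAt_of_mem_maximalAtlas (IsManifold.chart_mem_maximalAtlas x) hx
  refine (h1.comp x h2).congr_of_eventuallyEq ?_
  filter_upwards [c.chart.open_source.mem_nhds hx] with y hy
  change S.descend f y = f (S.descend id (c.chart.symm (c.chart y)))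
  rw [c.chart.left_inv hy, S.descend_eq f]

/-- The differential of the quotient map. -/
def dq (S : RegularModel m d n) (θ : S.Reg) : Param m d →L[ℝ] Model m d :=
  mfderiv 𝓘(ℝ, Param m d) 𝓘(ℝ, Model m d) S.q θ

/-- The differential of the descended realization map. -/
def dphiBar (S : RegularModel m d n) (x : S.Mreg) : Model m d →L[ℝ] Output n :=
  mfderiv 𝓘(ℝ, Model m d) 𝓘(ℝ, Output n) (S.descend id) x

theorem dphiBar_dq (S : RegularModel m d n) (θ : S.Reg) (u : Param m d) :
    S.dphiBar (S.q θ) (S.dq θ u) = S.dphi θ u := by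
  have h1 : MDifferentiableAt 𝓘(ℝ, Param m d) 𝓘(ℝ, Model m d) S.q θ :=
    (S.contMDiff_q θ).mdifferentiableAt (by simp)
  have h2 : MDifferentiableAt 𝓘(ℝ, Model m d) 𝓘(ℝ, Output n) (S.descend id) (S.q θ) :=
    (S.contMDiff_descend contDiff_id (S.q θ)).mdifferentiableAt (by simp)
  have h3 := h2.hasMFDerivAt.comp θ h1.hasMFDerivAt
  exact DFunLike.congr_fun (hasMFDerivAt_unique h3 (S.hasMFDerivAt_phi θ)) u

theorem dq_surjective (S : RegularModel m d n) (θ : S.Reg) : Function.Surjective (S.dq θ) := by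
  have h1 : (S.dq θ).toLinearMap.ker ≤ (S.dphi θ).toLinearMap.ker := by
    intro u hu
    have hu' : S.dq θ u = 0 := hu
    change S.dphi θ u = 0
    rw [← S.dphiBar_dq, hu', map_zero]
  have h2 := Submodule.finrank_mono h1
  have h3 := S.finrank_ker θ.2
  change Module.finrank ℝ (S.dphi θ).toLinearMap.ker = m at h3
  have h4 := LinearMap.finrank_range_add_finrank_ker (S.dq θ).toLinearMap
  have h5 : Module.finrank ℝ (Param m d) = m * (1 + d) := by
    simp [Module.finrank_pi_fintype]
  have h6 : m * (1 + d) = m * d + m := by ring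
  have h7 := (S.dq θ).toLinearMap.range.finrank_le
  have h8 : Module.finrank ℝ (Model m d) = m * d := by simp
  exact LinearMap.range_eq_top.1 (Submodule.eq_top_of_finrank_eq (by omega))

theorem ker_dq (S : RegularModel m d n) (θ : S.Reg) :
    (S.dq θ).toLinearMap.ker = orbitTangent S.p (θ : Param m d) := by
  have h1 : (S.dq θ).toLinearMap.ker ≤ (S.dphi θ).toLinearMap.ker := by
    intro u hu
    have hu' : S.dq θ u = 0 := hu
    change S.dphi θ u = 0
    rw [← S.dphiBar_dq, hu', map_zero]
  have h2 : (S.dphi θ).toLinearMap.ker = orbitTangent S.p (θ : Param m d) := S.ker_eq θ θ.2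
  rw [← h2]
  refine Submodule.eq_of_le_of_finrank_eq h1 ?_
  have h3 := S.finrank_ker θ.2
  change Module.finrank ℝ (S.dphi θ).toLinearMap.ker = m at h3
  have h4 := LinearMap.finrank_range_add_finrank_ker (S.dq θ).toLinearMap
  have h5 : Module.finrank ℝ (Param m d) = m * (1 + d) := by
    simp [Module.finrank_pi_fintype]
  have h6 : m * (1 + d) = m * d + m := by ring
  have h7 : (S.dq θ).toLinearMap.range = ⊤ := LinearMap.range_eq_top.2 (S.dq_surjective θ)
  rw [h7, finrank_top] at h4
  have h8 : Module.finrank ℝ (Model m d) = m * d := by simp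
  omega

/-- The function-induced form `g_θ(u, v) = (1/n) ⟨DΦ_X(θ) u, DΦ_X(θ) v⟩` on the regular set. -/
def funMetric (S : RegularModel m d n) : TensorField (Param m d) S.Reg := fun θ =>
  ((1 / n : ℝ) • restrictForm (innerSL ℝ) (S.dphi θ) :
    Param m d →L[ℝ] Param m d →L[ℝ] ℝ)

theorem funMetric_apply (S : RegularModel m d n) (θ : S.Reg) (u v : Param m d) :
    S.funMetric θ u v = 1 / n * inner ℝ (S.dphi θ u) (S.dphi θ v) := rfl

theorem exists_lift (S : RegularModel m d n) (θ : S.Reg) :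
    ∃ ℓ : Model m d →L[ℝ] Param m d, ∀ ξ, S.dq θ (ℓ ξ) = ξ := by
  obtain ⟨R, hR⟩ := (S.dq θ).toLinearMap.exists_rightInverse_of_surjective
    (LinearMap.range_eq_top.2 (S.dq_surjective θ))
  exact ⟨R.toContinuousLinearMap, fun ξ => LinearMap.congr_fun hR ξ⟩

/-- A linear choice of lifts of tangent vectors of the quotient to `T_θ Θ_reg`. -/
def lift (S : RegularModel m d n) (θ : S.Reg) : Model m d →L[ℝ] Param m d :=
  (S.exists_lift θ).choose

theorem dq_lift (S : RegularModel m d n) (θ : S.Reg) (ξ : Model m d) :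
    S.dq θ (S.lift θ ξ) = ξ := (S.exists_lift θ).choose_spec ξ

/-- The quotient metric: `ḡ_{[θ]}(ξ, η) = g_θ(u, v)` for lifts `u, v` of `ξ, η` to `T_θ Θ_reg`. It
depends neither on the lifts nor on the representative `θ`, see `quotMetric_dq`. -/
def quotMetric (S : RegularModel m d n) : TensorField (Model m d) S.Mreg := fun x =>
  restrictForm (F := Model m d) (F' := Param m d) (S.funMetric (Quotient.out x))
    (S.lift (Quotient.out x))

theorem quotMetric_dq (S : RegularModel m d n) (θ : S.Reg) (u v : Param m d) :
    S.quotMetric (S.q θ) (S.dq θ u) (S.dq θ v) = S.funMetric θ u v := by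
  have hx : S.q (Quotient.out (S.q θ)) = S.q θ := Quotient.out_eq (S.q θ)
  have h : ∀ w, S.dphi (Quotient.out (S.q θ) : S.Reg)
      (S.lift (Quotient.out (S.q θ)) (S.dq θ w)) = S.dphi θ w := by
    intro w
    rw [← S.dphiBar_dq, S.dq_lift, hx, S.dphiBar_dq]
  rw [S.funMetric_apply, ← h u, ← h v]
  rfl

theorem isMetricAt_quotMetric (S : RegularModel m d n) (x : S.Mreg) :
    IsMetricAt S.quotMetric x := by
  obtain ⟨θ, rfl⟩ := S.q_surjective x
  constructor
  · intro ξ η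
    obtain ⟨u, rfl⟩ := S.dq_surjective θ ξ
    obtain ⟨v, rfl⟩ := S.dq_surjective θ η
    rw [S.quotMetric_dq, S.quotMetric_dq, S.funMetric_apply, S.funMetric_apply, real_inner_comm]
  · intro ξ hξ
    obtain ⟨u, rfl⟩ := S.dq_surjective θ ξ
    rw [S.quotMetric_dq, S.funMetric_apply]
    have h1 : S.dphi θ u ≠ 0 := by
      intro h
      apply hξ
      have h2 : u ∈ (S.dphi θ).toLinearMap.ker := h
      have h3 : (S.dphi θ).toLinearMap.ker = orbitTangent S.p (θ : Param m d) :=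
        S.ker_eq θ θ.2
      rw [h3, ← S.ker_dq] at h2
      exact h2
    have hn : (0 : ℝ) < n := by
      rcases Nat.eq_zero_or_pos n with rfl | hn
      · exact absurd (Subsingleton.elim _ _) h1
      · exact_mod_cast hn
    have := real_inner_self_pos.2 h1
    positivity

/-- The empirical loss `L(θ) = Lt (Φ_X(θ))`. -/
def loss (S : RegularModel m d n) (Lt : Output n → ℝ) (θ : S.Reg) : ℝ := Lt (S.phi θ)

/-- The descended loss on the quotient. -/
def quotLoss (S : RegularModel m d n) (Lt : Output n → ℝ) : S.Mreg → ℝ := S.descend Lt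

/-- The gauge-fixed loss `L ∘ s`. -/
def gaugeLoss (S : RegularModel m d n) (Lt : Output n → ℝ) (s : S.Mreg → S.Reg) : S.Mreg → ℝ :=
  S.loss Lt ∘ s

/-- The reduced metric, the pullback along `s` of the quotient metric, where the latter is seen on
`Θ_reg` through the quotient map. -/
def gaugeMetric (S : RegularModel m d n) (s : S.Mreg → S.Reg) : TensorField (Model m d) S.Mreg :=
  pullback (E := Model m d) (E' := Param m d) s
    (pullback (E := Param m d) (E' := Model m d) S.q S.quotMetric)

/-- The curve `θ_t = s (γ t)` in the slice `s(U)` is a solution of the gradient flow of the loss on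
the slice: its velocity is tangent to the slice and `g(θ_t', w) = -DL(θ_t) w` for all vectors `w`
tangent to the slice. -/
def IsSliceGradientFlow (S : RegularModel m d n) (Lt : Output n → ℝ) (s : S.Mreg → S.Reg)
    (γ : ℝ → S.Mreg) (J : Set ℝ) : Prop :=
  ∀ t ∈ J, ∃ v : Param m d,
    HasMFDerivWithinAt 𝓘(ℝ, ℝ) 𝓘(ℝ, Param m d) (s ∘ γ) J t
      ((1 : ℝ →L[ℝ] ℝ).smulRight v) ∧
    v ∈ (mfderiv 𝓘(ℝ, Model m d) 𝓘(ℝ, Param m d) s (γ t)).range ∧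
    ∀ w ∈ (mfderiv 𝓘(ℝ, Model m d) 𝓘(ℝ, Param m d) s (γ t)).range,
      S.funMetric (s (γ t)) v w = -mfderiv 𝓘(ℝ, Param m d) 𝓘(ℝ, ℝ) (S.loss Lt) (s (γ t)) w

end RegularModel
end ShallowNet

end

/-! Since `q ∘ s = id` on the open set `U`, the chain rule gives `s^*(q^* ḡ) = (q ∘ s)^* ḡ = ḡ` and
`L ∘ s = L̄ ∘ q ∘ s = L̄` there (`gaugeMetric_eq`, `gaugeLoss_eq`). Gradient and Hessian at a point
depend only on germs, so those of the reduced pair are those of the quotient pair. The differential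
of `s` carries `ḡ` isometrically to `g` on vectors tangent to the slice, and `q` undoes `s`; hence
gradient lines in `U` and on the slice correspond.

What remains is a statement about a gradient field on a manifold near a critical point `z`. In the
preferred chart the field is `-G⁻¹ df`. As `df` vanishes at `z`, neither the derivative of `G⁻¹` nor
the Christoffel symbols contribute, and the linearization is `-G⁻¹ D²f`, minus the Hessian operator
(`hasLinearizationAt_neg_grad`). Metric and Hessian are diagonalized together
(`exists_diagonal_hessOp`). In these coordinates `p_i`, with eigenvalues `l_i`, the function is
`f(z) + ½ ∑ l_i p_i²` and the field is `-l_i p_i`, up to higher order. Each local estimate then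
compares a positive definite quadratic form with a remainder of order `o(‖y - y₀‖²)`
(`exists_mul_sq_le_of_isLittleO`).

Quadratic growth of `f` gives strictness and a barrier for Lyapunov stability; the strict bounds `μ
< l_i < Λ` give differential inequalities for the energy (`eventually_rate_le`), which integrate to
the rates and yield convergence. A negative eigenvalue gives a Chetaev function, an indefinite
quadratic form that grows along the flow (`exists_chetaev`). Solutions are produced by cutting the
field off in a chart and following the complete flow of the result until it leaves a ball
(`exists_solution_or_exit`). -/

noncomputable section

namespace ShallowNet

/-! ### Quadratic forms and the second order Taylor formula. -/

section Quadratic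

variable {E : Type*} [NormedAddCommGroup E] [NormedSpace ℝ E]

/-- Simultaneous diagonalization of an inner product and a symmetric bilinear form. -/
theorem exists_basis_diagonal {V : Type*} [AddCommGroup V] [Module ℝ V] [FiniteDimensional ℝ V]
    (B H : V →ₗ[ℝ] V →ₗ[ℝ] ℝ) (hB : ∀ u v, B u v = B v u) (hpos : ∀ u, u ≠ 0 → 0 < B u u)
    (hH : ∀ u v, H u v = H v u) :
    ∃ (k : ℕ) (b : Module.Basis (Fin k) ℝ V) (l : Fin k → ℝ),
      (∀ u v, B u v = ∑ i, b.repr u i * b.repr v i) ∧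
      ∀ u v, H u v = ∑ i, l i * b.repr u i * b.repr v i := by
  let core : InnerProductSpace.Core ℝ V :=
    { inner := fun u v => B u v
      conj_inner_symm := fun u v => by simpa using hB v u
      re_inner_nonneg := fun u => by
        by_cases hu : u = 0
        · simp [hu]
        · simpa using (hpos u hu).le
      add_left := fun u v w => by simp
      smul_left := fun u v r => by simp
      definite := fun u hu => by
        by_contra h
        exact (hpos u h).ne' hu }
  let _ : NormedAddCommGroup V := core.toNormedAddCommGroup
  let _ : InnerProductSpace ℝ V := InnerProductSpace.ofCore core.toCore
  have hin : ∀ u v : V, inner ℝ u v = B u v := fun _ _ => rfl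
  have hBinj : Function.Injective B := by
    rw [injective_iff_map_eq_zero]
    intro u hu
    by_contra h
    exact (hpos u h).ne' (by rw [hu]; rfl)
  let e : V ≃ₗ[ℝ] (V →ₗ[ℝ] ℝ) :=
    LinearEquiv.ofInjectiveOfFinrankEq B hBinj (Subspace.dual_finrank_eq (K := ℝ) (V := V)).symm
  -- `T` represents `H` through `B`, so it is self-adjoint for the inner product `B`; an orthonormal
  -- eigenbasis of `T` diagonalizes both forms.
  let T : V →ₗ[ℝ] V := e.symm.toLinearMap ∘ₗ H
  have hT : ∀ u v, B (T u) v = H u v := fun u v => by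
    have : e (T u) = H u := e.apply_symm_apply _
    exact LinearMap.congr_fun this v
  have hsymm : T.IsSymmetric := fun u v => by
    rw [hin, hin, hT, hB u, hT, hH]
  let b := hsymm.eigenvectorBasis (rfl : Module.finrank ℝ V = _)
  refine ⟨_, b.toBasis, hsymm.eigenvalues rfl, fun u v => ?_, fun u v => ?_⟩
  · rw [← hin, ← b.repr.inner_map_map u v, PiLp.inner_apply]
    refine Finset.sum_congr rfl fun i _ => ?_
    simp [mul_comm]
  · rw [← hT, ← hin, ← b.repr.inner_map_map (T u) v, PiLp.inner_apply]
    refine Finset.sum_congr rfl fun i _ => ?_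
    rw [hsymm.eigenvectorBasis_apply_self_apply]
    simp [mul_comm, b]

/-- `P` is an isometry for the inner product `B`, which is unrelated to the norm of `E`; with
respect to that norm it is only a bounded isomorphism. -/
theorem exists_continuousLinearEquiv_diagonal [FiniteDimensional ℝ E] (B H : E →L[ℝ] E →L[ℝ] ℝ)
    (hB : ∀ u v, B u v = B v u) (hpos : ∀ u, u ≠ 0 → 0 < B u u) (hH : ∀ u v, H u v = H v u) :
    ∃ (k : ℕ) (P : E ≃L[ℝ] EuclideanSpace ℝ (Fin k)) (l : Fin k → ℝ),
      (∀ u v, B u v = ∑ i, P u i * P v i) ∧ ∀ u v, H u v = ∑ i, l i * P u i * P v i := by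
  obtain ⟨k, b, l, h1, h2⟩ := exists_basis_diagonal
    ((ContinuousLinearMap.coeLM ℝ).comp B.toLinearMap) ((ContinuousLinearMap.coeLM ℝ).comp H.toLinearMap)
    hB hpos hH
  exact ⟨k, (b.equivFun.trans (WithLp.linearEquiv 2 ℝ (Fin k → ℝ)).symm).toContinuousLinearEquiv, l,
    h1, h2⟩

theorem exists_pos_forall_le {ι : Type*} [Finite ι] {a : ι → ℝ} (ha : ∀ i, 0 < a i) :
    ∃ c, 0 < c ∧ ∀ i, c ≤ a i := by
  rcases isEmpty_or_nonempty ι with h | h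
  · exact ⟨1, one_pos, fun i => h.elim i⟩
  · obtain ⟨i, hi⟩ := Finite.exists_min a
    exact ⟨a i, ha i, hi⟩

/-- A function whose second order part is a positive definite quadratic form is bounded below by a
multiple of the squared norm. -/
theorem exists_mul_sq_le_of_isLittleO {k : ℕ} (P : E ≃L[ℝ] EuclideanSpace ℝ (Fin k)) {a : Fin k → ℝ}
    (ha : ∀ i, 0 < a i) {R : E → ℝ} {y₀ : E}
    (hR : (fun y => R y - ∑ i, a i * P (y - y₀) i ^ 2) =o[𝓝 y₀] fun y => ‖y - y₀‖ ^ 2) :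
    ∃ c, 0 < c ∧ ∀ᶠ y in 𝓝 y₀, c * ‖y - y₀‖ ^ 2 ≤ R y := by
  obtain ⟨c, hc, hca⟩ := exists_pos_forall_le ha
  -- The summand 1 keeps `C` positive when `E` is trivial.
  let C : ℝ := ‖(P.symm : EuclideanSpace ℝ (Fin k) →L[ℝ] E)‖ + 1
  have hC : 0 < C := by positivity
  have hle : ∀ h : E, ‖h‖ ≤ C * ‖P h‖ := fun h => by
    have h1 := (P.symm : EuclideanSpace ℝ (Fin k) →L[ℝ] E).le_opNorm (P h)
    have h2 : (P.symm : EuclideanSpace ℝ (Fin k) →L[ℝ] E) (P h) = h := P.symm_apply_apply h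
    rw [h2] at h1
    refine h1.trans ?_
    gcongr
    simp [C]
  -- The quadratic form dominates twice the claimed constant; one half is spent on the remainder.
  have hsum : ∀ h : E, 2 * (c / (2 * C ^ 2)) * ‖h‖ ^ 2 ≤ ∑ i, a i * P h i ^ 2 := fun h => by
    have h1 : ‖h‖ ^ 2 ≤ C ^ 2 * ‖P h‖ ^ 2 := by
      rw [← mul_pow]; gcongr; exact hle h
    have h2 : c * ‖P h‖ ^ 2 ≤ ∑ i, a i * P h i ^ 2 := by
      rw [EuclideanSpace.real_norm_sq_eq, Finset.mul_sum]
      gcongr with i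
      exact hca i
    calc 2 * (c / (2 * C ^ 2)) * ‖h‖ ^ 2 ≤ 2 * (c / (2 * C ^ 2)) * (C ^ 2 * ‖P h‖ ^ 2) := by gcongr
      _ = c * ‖P h‖ ^ 2 := by field_simp
      _ ≤ _ := h2
  have hκ : 0 < c / (2 * C ^ 2) := by positivity
  refine ⟨c / (2 * C ^ 2), hκ, ?_⟩
  filter_upwards [hR.def hκ] with y hy
  have h1 := hsum (y - y₀)
  rw [Real.norm_eq_abs, norm_pow, norm_norm] at hy
  have h2 := (abs_le.1 hy).1
  linarith

/-- The second order Taylor formula at a critical point. -/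
theorem isLittleO_sub_half_fderiv_fderiv {f : E → ℝ} {y₀ : E} (hf : ContDiffAt ℝ 2 f y₀)
    (hcrit : fderiv ℝ f y₀ = 0) :
    (fun y => f y - f y₀ - 1 / 2 * fderiv ℝ (fderiv ℝ f) y₀ (y - y₀) (y - y₀)) =o[𝓝 y₀]
      fun y => ‖y - y₀‖ ^ 2 := by
  set H := fderiv ℝ (fderiv ℝ f) y₀ with hHdef
  have hH : HasFDerivAt (fderiv ℝ f) H y₀ :=
    ((hf.fderiv_right (m := 1) (by norm_num)).differentiableAt (by simp)).hasFDerivAt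
  have hdiff : ∀ᶠ y in 𝓝 y₀, DifferentiableAt ℝ f y :=
    (hf.eventually (by simp)).mono fun y hy => hy.differentiableAt (by simp)
  have hsymm : ∀ u v, H u v = H v u := fun u v =>
    second_derivative_symmetric_of_eventually (hdiff.mono fun y hy => hy.hasFDerivAt) hH u v
  have hlin : (fun y => fderiv ℝ f y - H (y - y₀)) =o[𝓝 y₀] fun y => y - y₀ := by
    simpa [hcrit] using hH.isLittleO
  rw [Asymptotics.isLittleO_iff]
  intro ε hε
  obtain ⟨δ, hδ, hball⟩ := Metric.eventually_nhds_iff_ball.1 (hdiff.and (hlin.def hε))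
  filter_upwards [Metric.ball_mem_nhds y₀ hδ] with y hy
  -- Mean value inequality for the Taylor remainder: by the symmetry of `H` its derivative at `z` is
  -- `Df(z) - H(z - y₀)`, which is at most `ε ‖y - y₀‖` on the closed ball through `y`. The segment
  -- from `y₀` to `y` supplies the second factor `‖y - y₀‖`.
  let Rm : E → ℝ := fun y => f y - f y₀ - 1 / 2 * H (y - y₀) (y - y₀)
  have hd : ∀ z ∈ Metric.ball y₀ δ, HasFDerivAt Rm (fderiv ℝ f z - H (z - y₀)) z := fun z hz => by
    have h1 : HasFDerivAt (fun z : E => z - y₀) (ContinuousLinearMap.id ℝ E) z :=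
      (hasFDerivAt_id z).sub_const y₀
    have h2 := (H.hasFDerivAt.comp z h1).clm_apply h1
    have h3 := (((hball z hz).1.hasFDerivAt.sub_const (f y₀)).sub (h2.const_mul (1 / 2)))
    refine h3.congr_fderiv ?_
    ext w
    simp only [map_sub, Function.comp_apply, sub_apply, smul_apply, add_apply, smul_eq_mul,
      ContinuousLinearMap.comp_apply, ContinuousLinearMap.flip_apply, ContinuousLinearMap.id_apply,
      hsymm w]
    ring
  have hconv : Convex ℝ (Metric.closedBall y₀ (dist y y₀)) := convex_closedBall _ _
  have hsub : Metric.closedBall y₀ (dist y y₀) ⊆ Metric.ball y₀ δ :=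
    Metric.closedBall_subset_ball hy
  have := hconv.norm_image_sub_le_of_norm_hasFDerivWithin_le (f := Rm) (C := ε * ‖y - y₀‖)
    (fun z hz => (hd z (hsub hz)).hasFDerivWithinAt)
    (fun z hz => ((hball z (hsub hz)).2).trans (by
      gcongr
      rw [← dist_eq_norm, ← dist_eq_norm]
      exact hz))
    (Metric.mem_closedBall_self dist_nonneg) (Metric.mem_closedBall.2 le_rfl)
  have h0 : Rm y₀ = 0 := by simp [Rm]
  rw [h0, sub_zero] at this
  calc ‖Rm y‖ ≤ ε * ‖y - y₀‖ * ‖y - y₀‖ := this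
    _ = ε * ‖‖y - y₀‖ ^ 2‖ := by rw [norm_pow, norm_norm]; ring

end Quadratic

/-! ### Local estimates at a critical point in diagonalizing coordinates. -/

section Estimates

variable {E : Type*} [NormedAddCommGroup E] [NormedSpace ℝ E] {k : ℕ}
  {P : E ≃L[ℝ] EuclideanSpace ℝ (Fin k)} {l : Fin k → ℝ} {f : E → ℝ} {y₀ : E}

theorem isLittleO_sub_half_sum (hf : ContDiffAt ℝ 2 f y₀) (hcrit : fderiv ℝ f y₀ = 0)
    (hH : ∀ u w, fderiv ℝ (fderiv ℝ f) y₀ u w = ∑ i, l i * P u i * P w i) :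
    (fun y => f y - f y₀ - ∑ i, l i / 2 * P (y - y₀) i ^ 2) =o[𝓝 y₀] fun y => ‖y - y₀‖ ^ 2 := by
  refine (isLittleO_sub_half_fderiv_fderiv hf hcrit).congr_left fun y => ?_
  rw [hH, Finset.mul_sum]
  congr 1
  exact Finset.sum_congr rfl fun i _ => by ring

theorem exists_mul_sq_le_sub (hf : ContDiffAt ℝ 2 f y₀) (hcrit : fderiv ℝ f y₀ = 0)
    (hH : ∀ u w, fderiv ℝ (fderiv ℝ f) y₀ u w = ∑ i, l i * P u i * P w i) (hl : ∀ i, 0 < l i) :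
    ∃ c, 0 < c ∧ ∀ᶠ y in 𝓝 y₀, c * ‖y - y₀‖ ^ 2 ≤ f y - f y₀ :=
  exists_mul_sq_le_of_isLittleO P (fun i => half_pos (hl i)) (isLittleO_sub_half_sum hf hcrit hH)

/-- If `u` and `w` have the first order parts `A` and `B`, then `⟨u, w⟩` has the second order part
`⟨A, B⟩`. -/
theorem isLittleO_bilinear {F F' : Type*} [NormedAddCommGroup F] [NormedSpace ℝ F]
    [NormedAddCommGroup F'] [NormedSpace ℝ F'] (b : F →L[ℝ] F' →L[ℝ] ℝ) {u : E → F} {w : E → F'}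
    {A : E →L[ℝ] F} {B : E →L[ℝ] F'} (hu : HasFDerivAt u A y₀) (hw : HasFDerivAt w B y₀)
    (hu0 : u y₀ = 0) (hw0 : w y₀ = 0) :
    (fun y => b (u y) (w y) - b (A (y - y₀)) (B (y - y₀))) =o[𝓝 y₀] fun y => ‖y - y₀‖ ^ 2 := by
  have h1 : (fun y => u y - A (y - y₀)) =o[𝓝 y₀] fun y => ‖y - y₀‖ := by
    simpa [hu0] using hu.isLittleO.norm_right
  have h2 : (fun y => w y - B (y - y₀)) =o[𝓝 y₀] fun y => ‖y - y₀‖ := by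
    simpa [hw0] using hw.isLittleO.norm_right
  have h3 : w =O[𝓝 y₀] fun y => ‖y - y₀‖ := by
    simpa [hw0] using hw.isBigO_sub.norm_right
  have h4 : (fun y => A (y - y₀)) =O[𝓝 y₀] fun y => ‖y - y₀‖ := (A.isBigO_sub _ _).norm_right
  have h5 : ∀ {p : E → F} {q : E → F'}, p =O[𝓝 y₀] (fun y => ‖y - y₀‖) →
      q =o[𝓝 y₀] (fun y => ‖y - y₀‖) →
      (fun y => b (p y) (q y)) =o[𝓝 y₀] fun y => ‖y - y₀‖ ^ 2 := fun {p q} hp hq => by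
    have : (fun y => b (p y) (q y)) =O[𝓝 y₀] fun y => ‖p y‖ * ‖q y‖ :=
      Asymptotics.IsBigO.of_bound ‖b‖ (Eventually.of_forall fun y => by
        simpa [mul_assoc] using b.le_opNorm₂ (p y) (q y))
    refine (this.trans_isLittleO (hp.norm_left.mul_isLittleO hq.norm_left)).congr_right fun y => ?_
    ring
  have h6 : ∀ {p : E → F} {q : E → F'}, p =o[𝓝 y₀] (fun y => ‖y - y₀‖) →
      q =O[𝓝 y₀] (fun y => ‖y - y₀‖) →
      (fun y => b (p y) (q y)) =o[𝓝 y₀] fun y => ‖y - y₀‖ ^ 2 := fun {p q} hp hq => by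
    have : (fun y => b (p y) (q y)) =O[𝓝 y₀] fun y => ‖p y‖ * ‖q y‖ :=
      Asymptotics.IsBigO.of_bound ‖b‖ (Eventually.of_forall fun y => by
        simpa [mul_assoc] using b.le_opNorm₂ (p y) (q y))
    refine (this.trans_isLittleO (hp.norm_left.mul_isBigO hq.norm_left)).congr_right fun y => ?_
    ring
  -- `b(u, w) - b(A, B) = b(u - A, w) + b(A, w - B)`, with `A` and `B` evaluated at `y - y₀`.
  refine ((h6 h1 h3).add (h5 h4 h2)).congr_left fun y => ?_
  simp
  ring

variable {v : E → E} {A : E →L[ℝ] E}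

/-- With `p = P (y - y₀)`, to second order `f - f y₀` is `½ ∑ l_i p_i²` and `-Df(v)` is `∑ l_i²
p_i²`. The gaps in the two inequalities are therefore `∑ l_i (l_i - μ) p_i²` and `∑ l_i (Λ - l_i)
p_i²`. Both are positive definite because the bounds on `l_i` are strict, so they absorb the
remainders. -/
theorem eventually_rate_le (hf : ContDiffAt ℝ 2 f y₀) (hcrit : fderiv ℝ f y₀ = 0)
    (hH : ∀ u w, fderiv ℝ (fderiv ℝ f) y₀ u w = ∑ i, l i * P u i * P w i)
    (hv : HasFDerivAt v (-A) y₀) (hv0 : v y₀ = 0) (hA : ∀ u i, P (A u) i = l i * P u i)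
    {μ Λ : ℝ} (hμ : 0 < μ) (hl : ∀ i, μ < l i ∧ l i < Λ) :
    ∀ᶠ y in 𝓝 y₀, 2 * μ * (f y - f y₀) ≤ -fderiv ℝ f y (v y) ∧
      -fderiv ℝ f y (v y) ≤ 2 * Λ * (f y - f y₀) := by
  have hH' : HasFDerivAt (fderiv ℝ f) (fderiv ℝ (fderiv ℝ f) y₀) y₀ :=
    ((hf.fderiv_right (m := 1) (by norm_num)).differentiableAt (by simp)).hasFDerivAt
  -- The identity of the dual space, read as a bilinear map, is the evaluation pairing of `Df` with
  -- `v`.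
  have h1 := isLittleO_bilinear (ContinuousLinearMap.id ℝ (E →L[ℝ] ℝ)) hH' hv hcrit hv0
  have h2 := isLittleO_sub_half_sum hf hcrit hH
  have hsq : ∀ y, fderiv ℝ (fderiv ℝ f) y₀ (y - y₀) ((-A) (y - y₀)) =
      -∑ i, l i ^ 2 * P (y - y₀) i ^ 2 := fun y => by
    rw [neg_apply, map_neg, hH]
    congr 1
    exact Finset.sum_congr rfl fun i _ => by rw [hA]; ring
  have h3 : (fun y => (-fderiv ℝ f y (v y) - 2 * μ * (f y - f y₀)) -
      ∑ i, l i * (l i - μ) * P (y - y₀) i ^ 2) =o[𝓝 y₀] fun y => ‖y - y₀‖ ^ 2 := by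
    refine (h1.neg_left.sub (h2.const_mul_left (2 * μ))).congr_left fun y => ?_
    simp only [ContinuousLinearMap.coe_id', id_eq]
    rw [hsq, mul_sub, Finset.mul_sum]
    have : ∑ i, l i * (l i - μ) * P (y - y₀) i ^ 2 = ∑ i, l i ^ 2 * P (y - y₀) i ^ 2 -
        ∑ i, 2 * μ * (l i / 2 * P (y - y₀) i ^ 2) := by
      rw [← Finset.sum_sub_distrib]
      exact Finset.sum_congr rfl fun i _ => by ring
    rw [this]
    ring
  have h4 : (fun y => (2 * Λ * (f y - f y₀) - -fderiv ℝ f y (v y)) -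
      ∑ i, l i * (Λ - l i) * P (y - y₀) i ^ 2) =o[𝓝 y₀] fun y => ‖y - y₀‖ ^ 2 := by
    refine (h1.add (h2.const_mul_left (2 * Λ))).congr_left fun y => ?_
    simp only [ContinuousLinearMap.coe_id', id_eq]
    rw [hsq, mul_sub, Finset.mul_sum]
    have : ∑ i, l i * (Λ - l i) * P (y - y₀) i ^ 2 = ∑ i, 2 * Λ * (l i / 2 * P (y - y₀) i ^ 2) -
        ∑ i, l i ^ 2 * P (y - y₀) i ^ 2 := by
      rw [← Finset.sum_sub_distrib]
      exact Finset.sum_congr rfl fun i _ => by ring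
    rw [this]
    ring
  obtain ⟨c, hc, hc'⟩ := exists_mul_sq_le_of_isLittleO P
    (fun i => mul_pos (hμ.trans (hl i).1) (sub_pos.2 (hl i).1)) h3
  obtain ⟨c', hc₂, hc₂'⟩ := exists_mul_sq_le_of_isLittleO P
    (fun i => mul_pos (hμ.trans (hl i).1) (sub_pos.2 (hl i).2)) h4
  filter_upwards [hc', hc₂'] with y h5 h6
  have h7 : 0 ≤ c * ‖y - y₀‖ ^ 2 := by positivity
  have h8 : 0 ≤ c' * ‖y - y₀‖ ^ 2 := by positivity
  exact ⟨by linarith, by linarith⟩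

/-- A Chetaev function for a linearization with a positive eigenvalue. -/
theorem exists_chetaev (hv : HasFDerivAt v (-A) y₀) (hv0 : v y₀ = 0)
    (hA : ∀ u i, P (A u) i = l i * P u i) (hl : ∃ i, l i < 0) :
    ∃ (α : ℝ) (Q : E → ℝ) (u : E), 0 < α ∧ ContDiff ℝ 1 Q ∧ (∀ t : ℝ, t ≠ 0 → 0 < Q (y₀ + t • u)) ∧
      ∀ᶠ y in 𝓝 y₀, α * Q y ≤ fderiv ℝ Q y (v y) := by
  obtain ⟨i₀, hi₀⟩ := hl
  -- The growth rate `c` is at most `-l i` for every negative `l i`; the other indices impose only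
  -- the harmless bound 1.
  obtain ⟨c, hc, hca⟩ := exists_pos_forall_le (a := fun i => if l i < 0 then -l i else 1) (fun i => by
    split_ifs with h
    · linarith
    · exact one_pos)
  -- To second order `DQ(v) - c Q` is `∑ (-2 σ_i l_i - c σ_i) p_i²`. The coefficient is `-2 l_i - c
  -- ≥ -l_i > 0` if `l_i < 0`, and `2 l_i + c > 0` otherwise. Zero eigenvalues thus join the
  -- positive ones, and degenerate critical points are covered.
  let σ : Fin k → ℝ := fun i => if l i < 0 then 1 else -1
  let Q : E → ℝ := fun y => ∑ i, σ i * P (y - y₀) i ^ 2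
  let p : Fin k → E →L[ℝ] ℝ := fun i =>
    (EuclideanSpace.proj i : EuclideanSpace ℝ (Fin k) →L[ℝ] ℝ) ∘L (P : E →L[ℝ] _)
  have hQd : ∀ y, HasFDerivAt Q (∑ i, (2 * σ i * P (y - y₀) i) • p i) y := fun y => by
    refine HasFDerivAt.fun_sum fun i _ => ?_
    have h1 : HasFDerivAt (fun y => P (y - y₀) i) (p i) y := by
      exact (p i).hasFDerivAt.comp y ((hasFDerivAt_id (𝕜 := ℝ) y).sub_const y₀)
    refine ((h1.pow 2).const_mul (σ i)).congr_fderiv ?_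
    ext w
    simp
    ring
  have hQc : ContDiff ℝ 1 Q := by
    refine ContDiff.sum fun i _ => contDiff_const.mul (ContDiff.pow ?_ 2)
    exact (p i).contDiff.comp (contDiff_id.sub contDiff_const)
  -- Along the eigendirection of a negative eigenvalue `Q` is `t²`.
  refine ⟨c, Q, P.symm (EuclideanSpace.single i₀ 1), hc, hQc, fun t ht => ?_, ?_⟩
  · have : Q (y₀ + t • P.symm (EuclideanSpace.single i₀ 1)) = t ^ 2 := by
      simp only [Q, add_sub_cancel_left, map_smul, P.apply_symm_apply]
      rw [Finset.sum_eq_single i₀]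
      · simp [σ, hi₀]
      · intro j _ hj
        simp [hj]
      · simp
    rw [this]
    positivity
  · have h1 : ∀ i, (fun y => P (y - y₀) i * P (v y) i - -(l i * P (y - y₀) i ^ 2)) =o[𝓝 y₀]
        fun y => ‖y - y₀‖ ^ 2 := fun i => by
      have h2 := isLittleO_bilinear (y₀ := y₀) (ContinuousLinearMap.mul ℝ ℝ)
        ((p i).hasFDerivAt.comp y₀ ((hasFDerivAt_id (𝕜 := ℝ) y₀).sub_const y₀))
        ((p i).hasFDerivAt.comp y₀ hv) (by simp) (by simp [hv0])
      refine h2.congr_left fun y => ?_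
      simp only [ContinuousLinearMap.mul_apply', Function.comp_apply, ContinuousLinearMap.comp_apply,
        neg_apply, map_neg, ContinuousLinearMap.id_apply, id_eq]
      have h3 : ∀ w, p i w = P w i := fun _ => rfl
      rw [h3, h3, h3, hA]
      ring
    have h4 : (fun y => (fderiv ℝ Q y (v y) - c * Q y) -
        ∑ i, (-(2 * σ i * l i) - c * σ i) * P (y - y₀) i ^ 2) =o[𝓝 y₀] fun y => ‖y - y₀‖ ^ 2 := by
      refine (Asymptotics.IsLittleO.sum (s := Finset.univ)
        fun i _ => (h1 i).const_mul_left (2 * σ i)).congr_left fun y => ?_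
      rw [(hQd y).fderiv]
      simp only [Q, FunLike.coe_sum, Finset.sum_apply, Finset.mul_sum, ← Finset.sum_sub_distrib]
      refine Finset.sum_congr rfl fun i _ => ?_
      have h3 : ((2 * σ i * P (y - y₀) i) • p i) (v y) = 2 * σ i * P (y - y₀) i * P (v y) i := rfl
      rw [h3]
      ring
    obtain ⟨κ, hκ, hκ'⟩ := exists_mul_sq_le_of_isLittleO P (fun i => by
      have := hca i
      by_cases h : l i < 0
      · simp only [σ, h, if_true] at this ⊢
        linarith
      · simp only [σ, h, if_false] at this ⊢
        linarith [not_lt.1 h]) h4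
    filter_upwards [hκ'] with y hy
    have : 0 ≤ κ * ‖y - y₀‖ ^ 2 := by positivity
    linarith

end Estimates

/-! ### Solutions of differential equations on balls: existence, exit, Lyapunov and Chetaev
arguments, energy decay. -/

section ODE

variable {E : Type*} [NormedAddCommGroup E] [NormedSpace ℝ E]

/-- A compactly supported `C¹` field is complete. -/
theorem exists_forall_hasDerivAt_of_hasCompactSupport [CompleteSpace E] {v : E → E}
    (hv : ContDiff ℝ 1 v) (hc : HasCompactSupport v) (x : E) :
    ∃ γ : ℝ → E, γ 0 = x ∧ ∀ t, HasDerivAt γ (v (γ t)) t := by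
  have hv' : ContMDiff 𝓘(ℝ, E) 𝓘(ℝ, E).tangent 1
      (fun x ↦ (⟨x, v x⟩ : TangentBundle 𝓘(ℝ, E) E)) :=
    contMDiff_vectorSpace_iff_contDiff.2 hv
  obtain ⟨K, hK⟩ := hv.lipschitzWith_of_hasCompactSupport hc one_ne_zero
  obtain ⟨L, hL⟩ := hc.exists_bound_of_continuous hv.continuous
  obtain ⟨γ, h0, hγ⟩ := (exists_isMIntegralCurve_iff_exists_isMIntegralCurveOn_Ioo hv' x).2 fun a => by
    -- The completeness criterion asks for a solution on `(-a, a)` for every real `a`, negative ones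
    -- included.
    let b : ℝ := max a 0
    have hb : 0 ≤ b := le_max_right _ _
    have hL0 : 0 ≤ L := (norm_nonneg _).trans (hL 0)
    -- The speed is at most `L`, so in time `b` a solution travels at most `L * b`. The field being
    -- bounded and Lipschitz everywhere, a ball of this radius is admissible for any `b`, and the
    -- time interval need not shrink.
    have hp : IsPicardLindelof (fun _ => v) (tmin := -b) (tmax := b)
        ⟨0, by simpa using hb, hb⟩ x (⟨L, hL0⟩ * ⟨b, hb⟩) 0 ⟨L, hL0⟩ K :=
      .of_time_independent (fun y _ => hL y) hK.lipschitzOnWith (by simp; exact le_rfl)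
    obtain ⟨γ, h0, h1⟩ := hp.exists_eq_forall_mem_Icc_hasDerivWithinAt₀
    refine ⟨γ, h0, fun t ht => ?_⟩
    have hab : a ≤ b := le_max_left _ _
    have hsub : Ioo (-a) a ⊆ Icc (-b) b := fun s hs => ⟨by linarith [hs.1], by linarith [hs.2]⟩
    exact ((h1 t (hsub ht)).mono hsub).hasFDerivWithinAt.hasMFDerivWithinAt
  refine ⟨γ, h0, fun t => ?_⟩
  have h : HasFDerivAt γ ((1 : ℝ →L[ℝ] ℝ).smulRight (v (γ t))) t :=
    hasMFDerivAt_iff_hasFDerivAt.1 (hγ t)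
  simpa using h.hasDerivAt

/-- A field on a ball can be changed outside of a smaller ball so that it is compactly supported. -/
theorem exists_contDiff_hasCompactSupport_eqOn [FiniteDimensional ℝ E] {v : E → E} {y₀ : E} {r R : ℝ}
    (hr : 0 < r) (hrR : r < R) (hv : ContDiffOn ℝ 1 v (Metric.ball y₀ R)) :
    ∃ w : E → E, ContDiff ℝ 1 w ∧ HasCompactSupport w ∧ EqOn w v (Metric.closedBall y₀ r) := by
  let χ : ContDiffBump y₀ := ⟨r, (r + R) / 2, hr, by linarith⟩
  refine ⟨fun y => χ y • v y, ?_, χ.hasCompactSupport.smul_right, fun y hy => ?_⟩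
  · rw [contDiff_iff_contDiffAt]
    intro y
    by_cases hy : y ∈ Metric.ball y₀ R
    · exact χ.contDiff.contDiffAt.smul (hv.contDiffAt (Metric.isOpen_ball.mem_nhds hy))
    · have h1 : (fun y => χ y • v y) =ᶠ[𝓝 y] fun _ => 0 := by
        have h2 : (Metric.closedBall y₀ ((r + R) / 2))ᶜ ∈ 𝓝 y :=
          Metric.isClosed_closedBall.isOpen_compl.mem_nhds fun h => hy
            (Metric.closedBall_subset_ball (by linarith) h)
        filter_upwards [h2] with z hz
        have : χ z = 0 := χ.zero_of_le_dist (not_le.1 fun h => hz h).le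
        rw [this, zero_smul]
      exact contDiffAt_const.congr_of_eventuallyEq h1
  · change χ y • v y = v y
    rw [χ.one_of_mem_closedBall hy, one_smul]

/-- A continuous curve that starts in an open ball stays in it or reaches its boundary. -/
theorem forall_mem_ball_or_exists_dist_eq {X : Type*} [PseudoMetricSpace X] {γ : ℝ → X}
    (hγ : Continuous γ) {y₀ : X} {r : ℝ} (h0 : γ 0 ∈ Metric.ball y₀ r) :
    (∀ t, 0 ≤ t → γ t ∈ Metric.ball y₀ r) ∨
      ∃ T, 0 < T ∧ dist (γ T) y₀ = r ∧ ∀ t ∈ Icc 0 T, γ t ∈ Metric.closedBall y₀ r := by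
  by_cases h : ∀ t, 0 ≤ t → γ t ∈ Metric.ball y₀ r
  · exact Or.inl h
  right
  push Not at h
  obtain ⟨t₁, ht₁, ht₁'⟩ := h
  have hd : Continuous fun t => dist (γ t) y₀ := hγ.dist continuous_const
  -- The infimum of this closed set is the first exit time. Membership gives distance at least `r`
  -- there, and the limit from the left gives at most `r`.
  let s : Set ℝ := Ici 0 ∩ {t | r ≤ dist (γ t) y₀}
  have hs : IsClosed s := isClosed_Ici.inter (isClosed_le continuous_const hd)
  have hne : s.Nonempty := ⟨t₁, ht₁, show r ≤ dist (γ t₁) y₀ from not_lt.1 ht₁'⟩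
  have hbdd : BddBelow s := ⟨0, fun t ht => ht.1⟩
  obtain ⟨hT0, hT⟩ := hs.csInf_mem hne hbdd
  have hlt : ∀ t, 0 ≤ t → t < sInf s → dist (γ t) y₀ < r := fun t ht htT => by
    by_contra hcon
    exact htT.not_ge (csInf_le hbdd ⟨ht, not_lt.1 hcon⟩)
  have hpos : 0 < sInf s := by
    refine lt_of_le_of_ne hT0 fun h => ?_
    rw [← h] at hT
    exact absurd (Metric.mem_ball.1 h0) (not_lt.2 hT)
  have hle : dist (γ (sInf s)) y₀ ≤ r := by
    refine le_of_tendsto (hd.continuousAt.tendsto.mono_left nhdsWithin_le_nhds :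
      Tendsto _ (𝓝[<] (sInf s)) _) ?_
    filter_upwards [Ioo_mem_nhdsLT hpos] with t ht
    exact (hlt t ht.1.le ht.2).le
  refine ⟨sInf s, hpos, le_antisymm hle hT, fun t ht => ?_⟩
  rcases ht.2.lt_or_eq with h | h
  · exact (hlt t ht.1 h).le
  · rw [h]; exact hle

/-- Solutions of a field on a ball exist until they reach the boundary of a smaller ball. -/
theorem exists_solution_or_exit [FiniteDimensional ℝ E] {v : E → E} {y₀ : E} {r R : ℝ}
    (hr : 0 < r) (hrR : r < R) (hv : ContDiffOn ℝ 1 v (Metric.ball y₀ R)) {x : E}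
    (hx : x ∈ Metric.ball y₀ r) :
    ∃ γ : ℝ → E, γ 0 = x ∧
      ((∀ t, 0 ≤ t → γ t ∈ Metric.ball y₀ r ∧ HasDerivAt γ (v (γ t)) t) ∨
        ∃ T, 0 < T ∧ dist (γ T) y₀ = r ∧
          ∀ t ∈ Icc 0 T, γ t ∈ Metric.closedBall y₀ r ∧ HasDerivAt γ (v (γ t)) t) := by
  -- The complete flow of the cut-off field `w` solves the original equation as long as it stays in
  -- the closed ball, where the two fields agree.
  obtain ⟨w, hw, hwc, hwv⟩ := exists_contDiff_hasCompactSupport_eqOn hr hrR hv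
  have : CompleteSpace E := FiniteDimensional.complete ℝ E
  obtain ⟨γ, h0, hγ⟩ := exists_forall_hasDerivAt_of_hasCompactSupport hw hwc x
  have hcont : Continuous γ := continuous_iff_continuousAt.2 fun t => (hγ t).continuousAt
  refine ⟨γ, h0, ?_⟩
  rcases forall_mem_ball_or_exists_dist_eq hcont (y₀ := y₀) (r := r) (by rwa [h0]) with h | h
  · exact Or.inl fun t ht => ⟨h t ht, hwv (Metric.ball_subset_closedBall (h t ht)) ▸ hγ t⟩
  · obtain ⟨T, hT, hd, h⟩ := h
    exact Or.inr ⟨T, hT, hd, fun t ht => ⟨h t ht, hwv (h t ht) ▸ hγ t⟩⟩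

/-- Near a strict minimum of a function that decreases along the field, solutions exist for all
times `t ≥ 0`. -/
theorem exists_solution_of_lyapunov [FiniteDimensional ℝ E] {v : E → E} {f : E → ℝ} {y₀ : E}
    {r R δ : ℝ} (hr : 0 < r) (hrR : r < R) (hv : ContDiffOn ℝ 1 v (Metric.ball y₀ R))
    (hf : ∀ y ∈ Metric.ball y₀ R, DifferentiableAt ℝ f y)
    (hdec : ∀ y ∈ Metric.ball y₀ R, fderiv ℝ f y (v y) ≤ 0)
    (hδ : ∀ y, dist y y₀ = r → δ ≤ f y) {x : E} (hx : x ∈ Metric.ball y₀ r) (hxδ : f x < δ) :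
    ∃ γ : ℝ → E, γ 0 = x ∧ ∀ t, 0 ≤ t → γ t ∈ Metric.ball y₀ r ∧ HasDerivAt γ (v (γ t)) t := by
  obtain ⟨γ, h0, h | ⟨T, hT, hd, h⟩⟩ := exists_solution_or_exit hr hrR hv hx
  · exact ⟨γ, h0, h⟩
  -- On reaching the sphere the value of `f` would be at least `δ`, yet it started below `δ` and
  -- never increased.
  exfalso
  have hsub := Metric.closedBall_subset_ball (x := y₀) hrR
  have hder : ∀ t ∈ Icc 0 T, HasDerivAt (f ∘ γ) (fderiv ℝ f (γ t) (v (γ t))) t := fun t ht =>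
    (hf _ (hsub (h t ht).1)).hasFDerivAt.comp_hasDerivAt t (h t ht).2
  have hanti : AntitoneOn (f ∘ γ) (Icc 0 T) := by
    refine antitoneOn_of_hasDerivWithinAt_nonpos (convex_Icc 0 T)
      (fun t ht => (hder t ht).continuousAt.continuousWithinAt)
      (fun t ht => (hder t (interior_subset ht)).hasDerivWithinAt)
      (fun t ht => hdec _ (hsub (h t (interior_subset ht)).1))
  have h1 : f (γ T) ≤ f (γ 0) := hanti ⟨le_rfl, hT.le⟩ ⟨hT.le, le_rfl⟩ hT.le
  rw [h0] at h1
  linarith [hδ _ hd]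

/-- Chetaev's instability criterion. -/
theorem exists_solution_exit_of_chetaev [FiniteDimensional ℝ E] {v : E → E} {Q : E → ℝ} {y₀ : E}
    {r R α : ℝ} (hr : 0 < r) (hrR : r < R) (hv : ContDiffOn ℝ 1 v (Metric.ball y₀ R))
    (hQ : ContDiff ℝ 1 Q) (hα : 0 < α)
    (hinc : ∀ y ∈ Metric.ball y₀ R, α * Q y ≤ fderiv ℝ Q y (v y)) {x : E}
    (hx : x ∈ Metric.ball y₀ r) (hxQ : 0 < Q x) :
    ∃ γ : ℝ → E, γ 0 = x ∧ ∃ T, 0 < T ∧ dist (γ T) y₀ = r ∧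
      ∀ t ∈ Icc 0 T, γ t ∈ Metric.closedBall y₀ r ∧ HasDerivAt γ (v (γ t)) t := by
  obtain ⟨γ, h0, h | h⟩ := exists_solution_or_exit hr hrR hv hx
  swap
  · exact ⟨γ, h0, h⟩
  exfalso
  obtain ⟨C, hC⟩ := (isCompact_closedBall y₀ r).bddAbove_image hQ.continuous.continuousOn
  have hball : Metric.ball y₀ r ⊆ Metric.ball y₀ R := Metric.ball_subset_ball hrR.le
  have hder : ∀ t, 0 ≤ t → HasDerivAt (fun t => -Q (γ t)) (-fderiv ℝ Q (γ t) (v (γ t))) t :=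
    fun t ht => ((hQ.differentiable (by simp) _).hasFDerivAt.comp_hasDerivAt t (h t ht).2).neg
  -- A linear lower bound suffices to contradict boundedness on the closed ball. Half the slope `α *
  -- Q x` makes the comparison strict at a contact point, where `Q` is at least `Q x`. The signs are
  -- reversed because the comparison lemma bounds functions from above.
  have hgrow : ∀ T, 0 ≤ T → Q x + α * Q x / 2 * T ≤ Q (γ T) := fun T hT => by
    have hB : ∀ t, HasDerivAt (fun t => -(Q x + α * Q x / 2 * t)) (-(α * Q x / 2)) t := fun t => by
      exact ((((hasDerivAt_id t).const_mul (α * Q x / 2)).const_add (Q x)).neg).congr_deriv (by simp)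
    have := image_le_of_deriv_right_lt_deriv_boundary' (a := 0) (b := T)
      (fun t ht => (hder t ht.1).continuousAt.continuousWithinAt)
      (fun t ht => (hder t ht.1).hasDerivWithinAt) (by simp [h0])
      (fun t _ => (hB t).continuousAt.continuousWithinAt) (fun t _ => (hB t).hasDerivWithinAt)
      (fun t ht heq => by
        have h1 := hinc _ (hball (h t ht.1).1)
        have h2 : Q (γ t) = Q x + α * Q x / 2 * t := neg_injective heq
        have h3 : 0 ≤ α * Q x / 2 * t := mul_nonneg (by positivity) ht.1
        have h4 : α * Q x ≤ α * Q (γ t) := by gcongr; linarith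
        have h5 : 0 < α * Q x := by positivity
        linarith) (⟨hT, le_rfl⟩ : T ∈ Icc 0 T)
    linarith
  have hCx : Q x ≤ C := hC ⟨x, Metric.ball_subset_closedBall hx, rfl⟩
  have h5 : 0 < α * Q x / 2 := by positivity
  have hC0 : 0 ≤ C / (α * Q x / 2) := div_nonneg (hxQ.le.trans hCx) h5.le
  -- At this time the linear bound equals `Q x + C`, above the maximum `C`.
  have h6 := hgrow (C / (α * Q x / 2)) hC0
  have h7 : Q (γ (C / (α * Q x / 2))) ≤ C :=
    hC ⟨_, Metric.ball_subset_closedBall (h _ hC0).1, rfl⟩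
  rw [mul_div_cancel₀ _ h5.ne'] at h6
  linarith

/-- The differential inequalities `-2 Λ φ ≤ φ' ≤ -2 μ φ` integrated. -/
theorem exp_mul_le_and_le_exp_mul {φ φ' : ℝ → ℝ} {μ Λ T : ℝ}
    (hd : ∀ t ∈ Ico 0 T, HasDerivWithinAt φ (φ' t) (Ico 0 T) t)
    (h : ∀ t ∈ Ico 0 T, 2 * μ * φ t ≤ -φ' t ∧ -φ' t ≤ 2 * Λ * φ t) :
    ∀ t ∈ Ico 0 T, Real.exp (-2 * Λ * t) * φ 0 ≤ φ t ∧ φ t ≤ Real.exp (-2 * μ * t) * φ 0 := by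
  -- Integrating factor: the bracket `2 a φ + φ'` is nonnegative for `a = Λ` and nonpositive for `a
  -- = μ`.
  have hder : ∀ a, ∀ t ∈ Ico 0 T, HasDerivWithinAt (fun t => Real.exp (2 * a * t) * φ t)
      (Real.exp (2 * a * t) * (2 * a * φ t + φ' t)) (Ico 0 T) t := fun a t ht => by
    have h1 : HasDerivAt (fun t => Real.exp (2 * a * t)) (Real.exp (2 * a * t) * (2 * a)) t := by
      simpa using ((hasDerivAt_id t).const_mul (2 * a)).exp
    exact (h1.hasDerivWithinAt.mul (hd t ht)).congr_deriv (by ring)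
  have hexp : ∀ a t, Real.exp (2 * a * t) * Real.exp (-2 * a * t) = 1 := fun a t => by
    rw [← Real.exp_add]; simp
  intro t ht
  have h0 : (0 : ℝ) ∈ Ico 0 T := ⟨le_rfl, ht.1.trans_lt ht.2⟩
  constructor
  · have hm : MonotoneOn (fun t => Real.exp (2 * Λ * t) * φ t) (Ico 0 T) :=
      monotoneOn_of_hasDerivWithinAt_nonneg (convex_Ico 0 T)
        (fun t ht => (hder Λ t ht).continuousWithinAt)
        (fun t ht => (hder Λ t (interior_subset ht)).mono interior_subset)
        (fun t ht => mul_nonneg (Real.exp_pos _).le (by linarith [(h t (interior_subset ht)).2]))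
    have h1 : φ 0 ≤ Real.exp (2 * Λ * t) * φ t := by simpa using hm h0 ht ht.1
    calc Real.exp (-2 * Λ * t) * φ 0 ≤ Real.exp (-2 * Λ * t) * (Real.exp (2 * Λ * t) * φ t) := by gcongr
      _ = Real.exp (2 * Λ * t) * Real.exp (-2 * Λ * t) * φ t := by ring
      _ = φ t := by rw [hexp, one_mul]
  · have hm : AntitoneOn (fun t => Real.exp (2 * μ * t) * φ t) (Ico 0 T) :=
      antitoneOn_of_hasDerivWithinAt_nonpos (convex_Ico 0 T)
        (fun t ht => (hder μ t ht).continuousWithinAt)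
        (fun t ht => (hder μ t (interior_subset ht)).mono interior_subset)
        (fun t ht => mul_nonpos_of_nonneg_of_nonpos (Real.exp_pos _).le
          (by linarith [(h t (interior_subset ht)).1]))
    have h1 : Real.exp (2 * μ * t) * φ t ≤ φ 0 := by simpa using hm h0 ht ht.1
    calc φ t = Real.exp (2 * μ * t) * Real.exp (-2 * μ * t) * φ t := by rw [hexp, one_mul]
      _ = Real.exp (-2 * μ * t) * (Real.exp (2 * μ * t) * φ t) := by ring
      _ ≤ Real.exp (-2 * μ * t) * φ 0 := by gcongr

end ODE

/-- A positive definite form on a finite dimensional space is nondegenerate. -/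
theorem isInvertible_of_pos {E : Type*} [NormedAddCommGroup E] [NormedSpace ℝ E]
    [FiniteDimensional ℝ E] {B : E →L[ℝ] E →L[ℝ] ℝ} (hsymm : ∀ u v, B u v = B v u)
    (hpos : ∀ u, u ≠ 0 → 0 < B u u) : B.IsInvertible :=
  isInvertible_of_isMetricAt (E := E) (M := E) (g := fun _ => B) (x := 0) ⟨hsymm, hpos⟩

/-! ### Differentials and integral curves read in the preferred chart. -/

section Chart

variable {E : Type*} [NormedAddCommGroup E] [NormedSpace ℝ E]
  {M : Type*} [TopologicalSpace M] [ChartedSpace E M] {z : M} {y : E}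

theorem contDiffOn_comp_extChartAt_symm {n : WithTop ℕ∞} [IsManifold 𝓘(ℝ, E) n M] {F : Type*}
    [NormedAddCommGroup F] [NormedSpace ℝ F] {f : M → F}
    (hf : ContMDiff 𝓘(ℝ, E) 𝓘(ℝ, F) n f) (z : M) :
    ContDiffOn ℝ n (fun y => f ((extChartAt 𝓘(ℝ, E) z).symm y)) (extChartAt 𝓘(ℝ, E) z).target :=
  contMDiffOn_iff_contDiffOn.1 (hf.comp_contMDiffOn (contMDiffOn_extChartAt_symm z))

variable [IsManifold 𝓘(ℝ, E) 1 M]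

theorem mdifferentiableAt_extChartAt_symm (hy : y ∈ (extChartAt 𝓘(ℝ, E) z).target) :
    MDifferentiableAt 𝓘(ℝ, E) 𝓘(ℝ, E) (extChartAt 𝓘(ℝ, E) z).symm y := by
  have h := mdifferentiableWithinAt_extChartAt_symm (I := 𝓘(ℝ, E)) hy
  rwa [modelWithCornersSelf_coe, range_id, mdifferentiableWithinAt_univ] at h

/-- The differential `Df_x`, as a map between the model spaces. -/
def mderiv {F : Type*} [NormedAddCommGroup F] [NormedSpace ℝ F] {N : Type*} [TopologicalSpace N]
    [ChartedSpace F N] (f : M → N) (x : M) : E →L[ℝ] F := mfderiv 𝓘(ℝ, E) 𝓘(ℝ, F) f x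

/-- The differential of the inverse of the preferred chart at `z`. -/
def symmDeriv (z : M) (y : E) : E →L[ℝ] E :=
  mfderiv 𝓘(ℝ, E) 𝓘(ℝ, E) (extChartAt 𝓘(ℝ, E) z).symm y

/-- The differential of the preferred chart at `z`. -/
def chartDeriv (z x : M) : E →L[ℝ] E := mfderiv 𝓘(ℝ, E) 𝓘(ℝ, E) (extChartAt 𝓘(ℝ, E) z) x

theorem chartDeriv_symmDeriv (hy : y ∈ (extChartAt 𝓘(ℝ, E) z).target) (u : E) :
    chartDeriv z ((extChartAt 𝓘(ℝ, E) z).symm y) (symmDeriv z y u) = u := by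
  have h := mfderiv_extChartAt_comp_mfderivWithin_extChartAt_symm (I := 𝓘(ℝ, E)) hy
  rw [modelWithCornersSelf_coe, range_id, mfderivWithin_univ] at h
  exact DFunLike.congr_fun h u

theorem symmDeriv_chartDeriv (hy : y ∈ (extChartAt 𝓘(ℝ, E) z).target) (u : E) :
    symmDeriv z y (chartDeriv z ((extChartAt 𝓘(ℝ, E) z).symm y) u) = u := by
  have h := mfderivWithin_extChartAt_symm_comp_mfderiv_extChartAt (I := 𝓘(ℝ, E)) hy
  rw [modelWithCornersSelf_coe, range_id, mfderivWithin_univ] at h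
  exact DFunLike.congr_fun h u

/-- `T_z M` is identified with the model space through the preferred chart at `z`, so this chart has
identity differential at its centre. Hence the metric and the Hessian operator at `z` agree with
their chart expressions without a change of basis. -/
theorem symmDeriv_self (z : M) (u : E) : symmDeriv z (extChartAt 𝓘(ℝ, E) z z) u = u := by
  have h := mfderivWithin_range_extChartAt_symm (I := 𝓘(ℝ, E)) (x := z)
  rw [modelWithCornersSelf_coe, range_id, mfderivWithin_univ] at h
  exact DFunLike.congr_fun h u

theorem fderiv_comp_extChartAt_symm {F : Type*} [NormedAddCommGroup F] [NormedSpace ℝ F] {f : M → F}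
    (hy : y ∈ (extChartAt 𝓘(ℝ, E) z).target)
    (hf : MDifferentiableAt 𝓘(ℝ, E) 𝓘(ℝ, F) f ((extChartAt 𝓘(ℝ, E) z).symm y)) :
    fderiv ℝ (fun y => f ((extChartAt 𝓘(ℝ, E) z).symm y)) y =
      mderiv f ((extChartAt 𝓘(ℝ, E) z).symm y) ∘L symmDeriv z y := by
  have h := hf.hasMFDerivAt.comp y (mdifferentiableAt_extChartAt_symm hy).hasMFDerivAt
  have h' : HasFDerivAt (fun y => f ((extChartAt 𝓘(ℝ, E) z).symm y))
      (mderiv f ((extChartAt 𝓘(ℝ, E) z).symm y) ∘L symmDeriv z y) y :=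
    hasMFDerivAt_iff_hasFDerivAt.1 h
  exact h'.fderiv

/-- Integral curves read in a chart. -/
theorem hasDerivWithinAt_extChartAt_comp {V : ∀ x : M, TangentSpace 𝓘(ℝ, E) x} {γ : ℝ → M} {J : Set ℝ}
    (hγ : IsMIntegralCurveOn γ V J) {t : ℝ} (ht : t ∈ J)
    (hs : γ t ∈ (extChartAt 𝓘(ℝ, E) z).source) :
    HasDerivWithinAt (extChartAt 𝓘(ℝ, E) z ∘ γ) (localField V z (extChartAt 𝓘(ℝ, E) z (γ t))) J t := by
  have hs' : γ t ∈ (chartAt E z).source := by rwa [extChartAt_source] at hs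
  have h1 := (mdifferentiableAt_extChartAt (I := 𝓘(ℝ, E)) hs').hasMFDerivAt.comp_hasMFDerivWithinAt t
    (hγ t ht)
  have h2 : HasFDerivWithinAt (extChartAt 𝓘(ℝ, E) z ∘ γ)
      (chartDeriv (E := E) z (γ t) ∘L ((1 : ℝ →L[ℝ] ℝ).smulRight (V (γ t) : E))) J t :=
    hasMFDerivWithinAt_iff_hasFDerivWithinAt.1 h1
  refine h2.hasDerivWithinAt.congr_deriv ?_
  -- The field is evaluated at the image of `γ t` under the chart and back. This point equals `γ t`,
  -- but the type of the vector depends on it, so the point is generalized before substituting.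
  have h3 : ∀ x : M, x = γ t → chartDeriv (E := E) z (γ t) (V (γ t)) = chartDeriv (E := E) z x (V x) := by
    rintro _ rfl; rfl
  refine Eq.trans ?_ (h3 _ ((extChartAt 𝓘(ℝ, E) z).left_inv hs))
  exact congrArg (chartDeriv (E := E) z (γ t)) (one_smul ℝ (V (γ t) : E))

/-- Solutions in a chart give integral curves. -/
theorem isMIntegralCurveOn_extChartAt_symm_comp {V : ∀ x : M, TangentSpace 𝓘(ℝ, E) x} {η : ℝ → E}
    {J : Set ℝ} (hη : ∀ t ∈ J, η t ∈ (extChartAt 𝓘(ℝ, E) z).target ∧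
      HasDerivAt η (localField V z (η t)) t) :
    IsMIntegralCurveOn (I := 𝓘(ℝ, E)) ((extChartAt 𝓘(ℝ, E) z).symm ∘ η) V J := by
  intro t ht
  obtain ⟨h1, h2⟩ := hη t ht
  have h3 := (mdifferentiableAt_extChartAt_symm h1).hasMFDerivAt.comp t
    h2.hasFDerivAt.hasMFDerivAt
  have h4 : symmDeriv z (η t) ∘L ContinuousLinearMap.toSpanSingleton ℝ (localField V z (η t)) =
      (1 : ℝ →L[ℝ] ℝ).smulRight (V ((extChartAt 𝓘(ℝ, E) z).symm (η t)) : E) := by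
    ext
    change symmDeriv z (η t) ((1 : ℝ) • localField V z (η t)) =
      (1 : ℝ) • (V ((extChartAt 𝓘(ℝ, E) z).symm (η t)) : E)
    rw [one_smul, one_smul]
    exact symmDeriv_chartDeriv h1 _
  exact (h4 ▸ h3 : HasMFDerivAt 𝓘(ℝ, ℝ) 𝓘(ℝ, E) _ t _).hasMFDerivWithinAt

end Chart

/-! ### Locality of gradient and Hessian, and their expressions in the chart. -/

section Gradient

variable {E : Type*} [NormedAddCommGroup E] [NormedSpace ℝ E]
  {M : Type*} [TopologicalSpace M] [ChartedSpace E M] {z : M} {y : E}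
  {g : TensorField E M} {f : M → ℝ}

/-- The Christoffel symbols contain first derivatives of the metric, so agreement near `z` is
required; for `grad_congr` the metrics need agree only at `z` itself. -/
theorem hess_congr {g' : TensorField E M} {f' : M → ℝ} (hg : ∀ᶠ x in 𝓝 z, g x = g' x)
    (hf : f =ᶠ[𝓝 z] f') : hess g f z = hess g' f' z := by
  have hc : Tendsto (extChartAt 𝓘(ℝ, E) z).symm (𝓝 (extChartAt 𝓘(ℝ, E) z z)) (𝓝 z) := by
    have := (continuousAt_extChartAt_symm (I := 𝓘(ℝ, E)) z).tendsto
    rwa [extChartAt_to_inv] at this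
  have h1 : localMetric g z =ᶠ[𝓝 (extChartAt 𝓘(ℝ, E) z z)] localMetric g' z :=
    (hc.eventually hg).mono fun y hy => by
      unfold localMetric pullback
      rw [hy]
  have h2 : localFun f z =ᶠ[𝓝 (extChartAt 𝓘(ℝ, E) z z)] localFun f' z := hc.eventually hf
  unfold hess
  simp only [christoffel, christoffelFirst, h1.fderiv_eq, h1.eq_of_nhds, h2.fderiv_eq,
    h2.fderiv.fderiv_eq]
  rfl

theorem grad_congr {g' : TensorField E M} {f' : M → ℝ} (hg : g z = g' z)
    (hf : f =ᶠ[𝓝 z] f') : grad g f z = grad g' f' z := by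
  unfold grad
  rw [hg, hf.mfderiv_eq]

theorem IsMetricAt.eq_of_apply_eq (hg : IsMetricAt g z) {u v : TangentSpace 𝓘(ℝ, E) z}
    (h : ∀ w, g z u w = g z v w) : u = v := by
  by_contra hne
  refine (hg.2 (u - v) (sub_ne_zero.2 hne)).ne' ?_
  have h1 : (g z : E →L[ℝ] E →L[ℝ] ℝ) u = g z v := ContinuousLinearMap.ext h
  have h2 : (g z : E →L[ℝ] E →L[ℝ] ℝ) (u - v) = 0 :=
    (map_sub (g z : E →L[ℝ] E →L[ℝ] ℝ) u v).trans (sub_eq_zero.2 h1)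
  exact DFunLike.congr_fun h2 _

theorem localMetric_apply (u v : E) : localMetric g z y u v =
    (g ((extChartAt 𝓘(ℝ, E) z).symm y) : E →L[ℝ] E →L[ℝ] ℝ) (symmDeriv z y u) (symmDeriv z y v) :=
  rfl

theorem localMetric_symm (hg : ∀ x, IsMetricAt g x) (u v : E) :
    localMetric g z y u v = localMetric g z y v u :=
  (hg ((extChartAt 𝓘(ℝ, E) z).symm y)).1 (symmDeriv z y u) (symmDeriv z y v)

variable [IsManifold 𝓘(ℝ, E) 1 M]

theorem localMetric_self : localMetric g z (extChartAt 𝓘(ℝ, E) z z) = g z := by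
  have h : ∀ (x : M), x = z → ∀ u v : E, (g x : E →L[ℝ] E →L[ℝ] ℝ) u v =
      (g z : E →L[ℝ] E →L[ℝ] ℝ) u v := by
    rintro _ rfl u v; rfl
  refine ContinuousLinearMap.ext fun u => ContinuousLinearMap.ext fun v => ?_
  rw [localMetric_apply, symmDeriv_self, symmDeriv_self]
  exact h _ (extChartAt_to_inv z) u v

theorem localMetric_pos (hy : y ∈ (extChartAt 𝓘(ℝ, E) z).target) (hg : ∀ x, IsMetricAt g x) {u : E}
    (hu : u ≠ 0) : 0 < localMetric g z y u u := by
  refine (hg _).2 _ fun h => hu ?_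
  have h1 : symmDeriv z y u = 0 := h
  rw [← chartDeriv_symmDeriv hy u, h1]
  exact map_zero _

theorem isInvertible_localMetric [FiniteDimensional ℝ E] (hy : y ∈ (extChartAt 𝓘(ℝ, E) z).target)
    (hg : ∀ x, IsMetricAt g x) : (localMetric g z y).IsInvertible :=
  isInvertible_of_pos (localMetric_symm hg) fun _ => localMetric_pos hy hg

/-- Naturality of the gradient: with `A` the differential of the inverse chart, `G(A⁻¹ grad f, u) =
g(grad f, A u) = df(A u)`. The resulting formula `-G⁻¹ df` reduces smoothness and linearization to
calculus in `E`. -/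
theorem localField_neg_grad [FiniteDimensional ℝ E] (hy : y ∈ (extChartAt 𝓘(ℝ, E) z).target)
    (hg : ∀ x, IsMetricAt g x) (hf : MDifferentiable 𝓘(ℝ, E) 𝓘(ℝ, ℝ) f) :
    localField (fun x => -grad g f x) z y =
      -(localMetric g z y).inverse (fderiv ℝ (localFun f z) y) := by
  obtain ⟨w, hw⟩ : ∃ w : E, w = grad g f ((extChartAt 𝓘(ℝ, E) z).symm y) := ⟨_, rfl⟩
  have hgw : ∀ v : E, (g ((extChartAt 𝓘(ℝ, E) z).symm y) : E →L[ℝ] E →L[ℝ] ℝ) w v =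
      mderiv f ((extChartAt 𝓘(ℝ, E) z).symm y) v := fun v => by
    rw [hw]; exact apply_grad (hg _) f v
  have h1 : localField (fun x => -grad g f x) z y =
      -chartDeriv z ((extChartAt 𝓘(ℝ, E) z).symm y) w := by
    rw [hw]; exact map_neg (chartDeriv (E := E) z ((extChartAt 𝓘(ℝ, E) z).symm y)) _
  rw [h1, neg_inj, eq_comm, (isInvertible_localMetric hy hg).inverse_apply_eq]
  refine ContinuousLinearMap.ext fun u => ?_
  rw [localMetric_apply, symmDeriv_chartDeriv hy, hgw]
  exact DFunLike.congr_fun (fderiv_comp_extChartAt_symm hy (hf _)) u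

theorem fderiv_localFun_self (hf : MDifferentiable 𝓘(ℝ, E) 𝓘(ℝ, ℝ) f)
    (hz : mfderiv 𝓘(ℝ, E) 𝓘(ℝ, ℝ) f z = 0) :
    fderiv ℝ (localFun f z) (extChartAt 𝓘(ℝ, E) z z) = 0 := by
  have h : ∀ x : M, x = z → ∀ u : E, (mfderiv 𝓘(ℝ, E) 𝓘(ℝ, ℝ) f x : E →L[ℝ] ℝ) u = 0 := by
    rintro _ rfl u; rw [hz]; rfl
  ext u
  have h1 := fderiv_comp_extChartAt_symm (mem_extChartAt_target z) (hf _)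
  exact (DFunLike.congr_fun h1 u).trans (h _ (extChartAt_to_inv z) _)

/-- The Christoffel term is contracted with the differential of `f`, which vanishes at `z`; the
Hessian there does not see the metric. -/
theorem hess_of_mfderiv_eq_zero (hf : MDifferentiable 𝓘(ℝ, E) 𝓘(ℝ, ℝ) f)
    (hz : mfderiv 𝓘(ℝ, E) 𝓘(ℝ, ℝ) f z = 0) :
    hess g f z = fderiv ℝ (fderiv ℝ (localFun f z)) (extChartAt 𝓘(ℝ, E) z z) := by
  unfold hess
  simp only [fderiv_localFun_self hf hz, map_zero, ContinuousLinearMap.zero_comp, sub_zero]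
  rfl

end Gradient

/-! ### Smoothness and linearization of the gradient field. -/

section Smooth

variable {E : Type*} [NormedAddCommGroup E] [NormedSpace ℝ E] [FiniteDimensional ℝ E]
  {M : Type*} [TopologicalSpace M] [ChartedSpace E M] [IsManifold 𝓘(ℝ, E) 2 M] {z : M}
  {g : TensorField E M} {f : M → ℝ}

theorem contDiffOn_localField_neg_grad
    (hg : ∀ x, IsMetricAt g x) (hf : ContMDiff 𝓘(ℝ, E) 𝓘(ℝ, ℝ) 2 f)
    (hG : ContDiffOn ℝ 1 (localMetric g z) (extChartAt 𝓘(ℝ, E) z).target) :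
    ContDiffOn ℝ 1 (localField (fun x => -grad g f x) z) (extChartAt 𝓘(ℝ, E) z).target := by
  have : CompleteSpace E := FiniteDimensional.complete ℝ E
  have ho := isOpen_extChartAt_target (I := 𝓘(ℝ, E)) z
  have h1 : ContDiffOn ℝ 1 (fun y => -(localMetric g z y).inverse (fderiv ℝ (localFun f z) y))
      (extChartAt 𝓘(ℝ, E) z).target := by
    intro y hy
    have h2 : ContDiffAt ℝ 1 (fderiv ℝ (localFun f z)) y :=
      ((contDiffOn_comp_extChartAt_symm hf z).contDiffAt (ho.mem_nhds hy)).fderiv_right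
        (by norm_num)
    have h3 : ContDiffAt ℝ 1 (fun y => (localMetric g z y).inverse) y :=
      (isInvertible_localMetric hy hg).contDiffAt_map_inverse.comp y
        (hG.contDiffAt (ho.mem_nhds hy))
    exact (h3.clm_apply h2).neg.contDiffWithinAt
  exact h1.congr fun y hy => localField_neg_grad hy hg (hf.mdifferentiable (by simp))

/-- By the product rule for `-G⁻¹ df`, the derivative of `G⁻¹` is applied to `df = 0`; only `-G⁻¹
D²f` survives, and at a critical point `D²f` is the Hessian. -/
theorem hasLinearizationAt_neg_grad
    (hg : ∀ x, IsMetricAt g x) (hf : ContMDiff 𝓘(ℝ, E) 𝓘(ℝ, ℝ) 2 f)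
    (hG : ContDiffOn ℝ 1 (localMetric g z) (extChartAt 𝓘(ℝ, E) z).target)
    (hz : mfderiv 𝓘(ℝ, E) 𝓘(ℝ, ℝ) f z = 0) :
    HasLinearizationAt (fun x => -grad g f x) z (-hessOp g f z) := by
  have : CompleteSpace E := FiniteDimensional.complete ℝ E
  have hfd := hf.mdifferentiable (by simp)
  have hy := mem_extChartAt_target (I := 𝓘(ℝ, E)) z
  have hn := extChartAt_target_mem_nhds (I := 𝓘(ℝ, E)) z
  have h2 : HasFDerivAt (fderiv ℝ (localFun f z))
      (fderiv ℝ (fderiv ℝ (localFun f z)) (extChartAt 𝓘(ℝ, E) z z)) (extChartAt 𝓘(ℝ, E) z z) :=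
    ((((contDiffOn_comp_extChartAt_symm hf z).contDiffAt hn).fderiv_right
      (m := 1) (by norm_num)).differentiableAt (by simp)).hasFDerivAt
  have h3 : DifferentiableAt ℝ (fun y => (localMetric g z y).inverse) (extChartAt 𝓘(ℝ, E) z z) :=
    ((isInvertible_localMetric hy hg).contDiffAt_map_inverse.comp _
      (hG.contDiffAt hn)).differentiableAt (by simp)
  have h4 := (h3.hasFDerivAt.clm_apply h2).neg
  have h5 : localField (fun x => -grad g f x) z =ᶠ[𝓝 (extChartAt 𝓘(ℝ, E) z z)]
      fun y => -(localMetric g z y).inverse (fderiv ℝ (localFun f z) y) := by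
    filter_upwards [hn] with y hy
    exact localField_neg_grad hy hg hfd
  refine (h4.congr_of_eventuallyEq h5).congr_fderiv ?_
  ext u
  rw [fderiv_localFun_self hfd hz, localMetric_self]
  unfold hessOp
  rw [hess_of_mfderiv_eq_zero hfd hz]
  simp
  rfl

end Smooth

/-- In the coordinates `P` the operator `a - A` multiplies the `i`-th coordinate by `a - l i`, so it
is bijective exactly when no factor vanishes. -/
theorem spectrum_eq_range {E : Type*} [NormedAddCommGroup E] [NormedSpace ℝ E]
    [FiniteDimensional ℝ E] {k : ℕ} (P : E ≃L[ℝ] EuclideanSpace ℝ (Fin k)) {l : Fin k → ℝ}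
    {A : E →L[ℝ] E} (hA : ∀ u i, P (A u) i = l i * P u i) : spectrum ℝ A = range l := by
  have : CompleteSpace E := FiniteDimensional.complete ℝ E
  have hsub : ∀ a u i, P ((algebraMap ℝ (E →L[ℝ] E) a - A) u) i = (a - l i) * P u i := fun a u i => by
    have h1 : (algebraMap ℝ (E →L[ℝ] E) a - A) u = a • u - A u := by
      simp [Algebra.algebraMap_eq_smul_one]
    rw [h1, map_sub, map_smul, PiLp.sub_apply, PiLp.smul_apply, hA, smul_eq_mul]
    ring
  ext a
  rw [spectrum.mem_iff, ContinuousLinearMap.isUnit_iff_bijective]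
  constructor
  · intro h
    by_contra hcon
    have hinj : Function.Injective (algebraMap ℝ (E →L[ℝ] E) a - A) := by
      rw [injective_iff_map_eq_zero]
      intro u hu
      refine P.map_eq_zero_iff.1 (PiLp.ext fun i => ?_)
      have h1 := hsub a u i
      rw [hu, map_zero, PiLp.zero_apply, eq_comm, mul_eq_zero] at h1
      exact h1.resolve_left fun h2 => hcon ⟨i, (sub_eq_zero.1 h2).symm⟩
    exact h ⟨hinj, (LinearMap.injective_iff_surjective
      (f := (algebraMap ℝ (E →L[ℝ] E) a - A).toLinearMap)).1 hinj⟩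
  · rintro ⟨i, rfl⟩ h
    have h1 : P.symm (EuclideanSpace.single i 1) = 0 := by
      refine (injective_iff_map_eq_zero _).1 h.1 _ (P.map_eq_zero_iff.1 (PiLp.ext fun j => ?_))
      rw [hsub, P.apply_symm_apply, PiLp.zero_apply]
      by_cases hj : j = i
      · rw [hj, sub_self, zero_mul]
      · simp [hj]
    have h2 := congrArg (fun w : EuclideanSpace ℝ (Fin k) => w i) (P.symm.map_eq_zero_iff.1 h1)
    simp at h2

/-! ### Gradient flow near a critical point: strict minima, rates, stability and instability. -/

section Stability

variable {E : Type*} [NormedAddCommGroup E] [NormedSpace ℝ E]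
  {M : Type*} [TopologicalSpace M] [ChartedSpace E M] {z : M}
  {g : TensorField E M} {f : M → ℝ}

theorem localFun_extChartAt {x : M} (hx : x ∈ (extChartAt 𝓘(ℝ, E) z).source) :
    localFun f z (extChartAt 𝓘(ℝ, E) z x) = f x := by
  unfold localFun
  rw [(extChartAt 𝓘(ℝ, E) z).left_inv hx]

theorem eventually_mem_source_and_extChartAt {p : E → Prop}
    (hp : ∀ᶠ y in 𝓝 (extChartAt 𝓘(ℝ, E) z z), p y) :
    ∀ᶠ x in 𝓝 z, x ∈ (extChartAt 𝓘(ℝ, E) z).source ∧ p (extChartAt 𝓘(ℝ, E) z x) :=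
  Eventually.and (extChartAt_source_mem_nhds (I := 𝓘(ℝ, E)) z) ((continuousAt_extChartAt z).eventually hp)

theorem contDiffAt_localFun [IsManifold 𝓘(ℝ, E) 2 M]
    (hf : ContMDiff 𝓘(ℝ, E) 𝓘(ℝ, ℝ) 2 f) (z : M) :
    ContDiffAt ℝ 2 (localFun f z) (extChartAt 𝓘(ℝ, E) z z) :=
  (contDiffOn_comp_extChartAt_symm hf z).contDiffAt (extChartAt_target_mem_nhds z)

variable [FiniteDimensional ℝ E]

/-- The derivative of `f` along a gradient line. -/
theorem hasDerivWithinAt_comp_gradientLine (hg : ∀ x, IsMetricAt g x)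
    (hf : MDifferentiable 𝓘(ℝ, E) 𝓘(ℝ, ℝ) f) {γ : ℝ → M} {J : Set ℝ}
    (hγ : IsMIntegralCurveOn γ (fun x => -grad g f x) J) {t : ℝ} (ht : t ∈ J) :
    HasDerivWithinAt (f ∘ γ) (-g (γ t) (grad g f (γ t)) (grad g f (γ t))) J t := by
  obtain ⟨w, hw⟩ : ∃ w : E, w = grad g f (γ t) := ⟨_, rfl⟩
  obtain ⟨D, hD⟩ : ∃ D : E →L[ℝ] ℝ, D = mfderiv 𝓘(ℝ, E) 𝓘(ℝ, ℝ) f (γ t) := ⟨_, rfl⟩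
  have h1 := (hf (γ t)).hasMFDerivAt.comp_hasMFDerivWithinAt t (hγ t ht)
  have h2 : HasFDerivWithinAt (f ∘ γ) (D ∘L ((1 : ℝ →L[ℝ] ℝ).smulRight (-w))) J t := by
    rw [hw, hD]; exact hasMFDerivWithinAt_iff_hasFDerivWithinAt.1 h1
  refine h2.hasDerivWithinAt.congr_deriv ?_
  have h3 : (g (γ t) : E →L[ℝ] E →L[ℝ] ℝ) w w = D w := by
    rw [hw, hD]; exact apply_grad (hg _) f _
  have h4 : (D ∘L ((1 : ℝ →L[ℝ] ℝ).smulRight (-w))) 1 = -D w := by simp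
  rw [h4, ← h3, hw]

theorem antitoneOn_comp_gradientLine (hg : ∀ x, IsMetricAt g x)
    (hf : MDifferentiable 𝓘(ℝ, E) 𝓘(ℝ, ℝ) f) {γ : ℝ → M} {J : Set ℝ} (hJ : Convex ℝ J)
    (hγ : IsMIntegralCurveOn γ (fun x => -grad g f x) J) : AntitoneOn (f ∘ γ) J := by
  have h := fun t ht => hasDerivWithinAt_comp_gradientLine hg hf hγ (t := t) ht
  refine antitoneOn_of_hasDerivWithinAt_nonpos hJ (fun t ht => (h t ht).continuousWithinAt)
    (fun t ht => (h t (interior_subset ht)).mono interior_subset) fun t _ => ?_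
  have h1 : ∀ u, 0 ≤ g (γ t) u u := fun u => by
    by_cases hu : u = 0
    · rw [hu, map_zero]
    · exact ((hg _).2 u hu).le
  exact neg_nonpos.2 (h1 _)

variable [IsManifold 𝓘(ℝ, E) 2 M]

/-- With `w = G⁻¹ df` the left side is `-G(w, w)`. This pointwise form of energy decrease is what
the existence of solutions rests on, before any curve is at hand. -/
theorem fderiv_localFun_localField_nonpos {y : E} (hy : y ∈ (extChartAt 𝓘(ℝ, E) z).target)
    (hg : ∀ x, IsMetricAt g x) (hf : MDifferentiable 𝓘(ℝ, E) 𝓘(ℝ, ℝ) f) :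
    fderiv ℝ (localFun f z) y (localField (fun x => -grad g f x) z y) ≤ 0 := by
  rw [localField_neg_grad hy hg hf, map_neg]
  set w := (localMetric g z y).inverse (fderiv ℝ (localFun f z) y) with hw
  have h1 : fderiv ℝ (localFun f z) y = localMetric g z y w :=
    (isInvertible_localMetric hy hg).inverse_apply_eq.1 hw.symm
  rw [h1]
  by_cases h : w = 0
  · simp [h]
  · exact neg_nonpos.2 (localMetric_pos hy hg h).le

theorem localField_neg_grad_self (hg : ∀ x, IsMetricAt g x)
    (hf : MDifferentiable 𝓘(ℝ, E) 𝓘(ℝ, ℝ) f) (hz : mfderiv 𝓘(ℝ, E) 𝓘(ℝ, ℝ) f z = 0) :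
    localField (fun x => -grad g f x) z (extChartAt 𝓘(ℝ, E) z z) = 0 := by
  rw [localField_neg_grad (mem_extChartAt_target z) hg hf, fderiv_localFun_self hf hz, map_zero,
    neg_zero]

/-- At a critical point the metric and the Hessian can be diagonalized simultaneously. -/
theorem exists_diagonal_hessOp (hg : ∀ x, IsMetricAt g x) (hf : ContMDiff 𝓘(ℝ, E) 𝓘(ℝ, ℝ) 2 f)
    (hz : mfderiv 𝓘(ℝ, E) 𝓘(ℝ, ℝ) f z = 0) :
    ∃ (k : ℕ) (P : E ≃L[ℝ] EuclideanSpace ℝ (Fin k)) (l : Fin k → ℝ),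
      (∀ u w, fderiv ℝ (fderiv ℝ (localFun f z)) (extChartAt 𝓘(ℝ, E) z z) u w =
        ∑ i, l i * P u i * P w i) ∧
      (∀ u i, P ((hessOp g f z : E →L[ℝ] E) u) i = l i * P u i) ∧
      spectrum ℝ (hessOp g f z) = range l := by
  obtain ⟨A, hA⟩ : ∃ A : E →L[ℝ] E, A = hessOp g f z := ⟨_, rfl⟩
  obtain ⟨B, hB⟩ : ∃ B : E →L[ℝ] E →L[ℝ] ℝ, B = g z := ⟨_, rfl⟩
  set H := fderiv ℝ (fderiv ℝ (localFun f z)) (extChartAt 𝓘(ℝ, E) z z) with hH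
  have hess_eq : hess g f z = H := hess_of_mfderiv_eq_zero (hf.mdifferentiable (by simp)) hz
  have hAB : ∀ u v, B (A u) v = H u v := fun u v => by
    rw [hA, hB, ← hess_eq]; exact apply_hessOp (hg z) f u v
  have hHsymm : ∀ u v, H u v = H v u := fun u v =>
    second_derivative_symmetric_of_eventually
      (((contDiffAt_localFun hf z).eventually (by simp)).mono fun y hy =>
        (hy.differentiableAt (by simp)).hasFDerivAt)
      ((((contDiffAt_localFun hf z).fderiv_right (m := 1) (by norm_num)).differentiableAt
        (by simp)).hasFDerivAt) u v
  obtain ⟨k, P, l, h1, h2⟩ := exists_continuousLinearEquiv_diagonal B H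
    (fun u v => by rw [hB]; exact (hg z).1 u v) (fun u hu => by rw [hB]; exact (hg z).2 u hu) hHsymm
  have h3 : ∀ u i, P (A u) i = l i * P u i := fun u i => by
    -- Pairing through `B` with the `i`-th basis vector reads off the `i`-th coordinate.
    have h4 := hAB u (P.symm (EuclideanSpace.single i 1))
    rw [h1, h2, P.apply_symm_apply] at h4
    simpa [Finset.sum_ite_eq'] using h4
  refine ⟨k, P, l, h2, fun u i => by rw [← hA]; exact h3 u i, ?_⟩
  have h5 := spectrum_eq_range P h3
  rw [hA] at h5
  exact h5

/-- Quadratic growth serves three times: for strictness of the minimum, as a barrier on small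
spheres, and to turn decay of the energy into convergence of the curve. -/
theorem exists_mul_sq_le_localFun_sub (hg : ∀ x, IsMetricAt g x)
    (hf : ContMDiff 𝓘(ℝ, E) 𝓘(ℝ, ℝ) 2 f) (hz : mfderiv 𝓘(ℝ, E) 𝓘(ℝ, ℝ) f z = 0)
    (hpos : ∀ l ∈ spectrum ℝ (hessOp g f z), 0 < l) :
    ∃ c, 0 < c ∧ ∀ᶠ y in 𝓝 (extChartAt 𝓘(ℝ, E) z z),
      c * ‖y - extChartAt 𝓘(ℝ, E) z z‖ ^ 2 ≤ localFun f z y - f z := by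
  obtain ⟨k, P, l, h1, -, h3⟩ := exists_diagonal_hessOp hg hf hz
  have h := exists_mul_sq_le_sub (contDiffAt_localFun hf z)
    (fderiv_localFun_self (hf.mdifferentiable (by simp)) hz) h1 fun i => hpos _ (h3 ▸ ⟨i, rfl⟩)
  rwa [localFun_extChartAt (mem_extChartAt_source z)] at h

/-- A nondegenerate minimum is strict. -/
theorem eventually_lt_of_hessOp_pos (hg : ∀ x, IsMetricAt g x)
    (hf : ContMDiff 𝓘(ℝ, E) 𝓘(ℝ, ℝ) 2 f) (hz : mfderiv 𝓘(ℝ, E) 𝓘(ℝ, ℝ) f z = 0)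
    (hpos : ∀ l ∈ spectrum ℝ (hessOp g f z), 0 < l) : ∀ᶠ x in 𝓝[≠] z, f z < f x := by
  obtain ⟨c, hc, h⟩ := exists_mul_sq_le_localFun_sub hg hf hz hpos
  rw [eventually_nhdsWithin_iff]
  filter_upwards [eventually_mem_source_and_extChartAt h] with x ⟨hx, hcx⟩ hne
  have h1 : extChartAt 𝓘(ℝ, E) z x - extChartAt 𝓘(ℝ, E) z z ≠ 0 := fun h0 =>
    hne ((extChartAt 𝓘(ℝ, E) z).injOn hx (mem_extChartAt_source z) (sub_eq_zero.1 h0))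
  rw [localFun_extChartAt hx] at hcx
  have h2 : 0 < c * ‖extChartAt 𝓘(ℝ, E) z x - extChartAt 𝓘(ℝ, E) z z‖ ^ 2 := by positivity
  linarith

/-- The energy of a gradient line near a nondegenerate minimum decays at rates given by the extremal
eigenvalues of the Hessian. -/
theorem exists_nhds_rate (hg : ∀ x, IsMetricAt g x) (hf : ContMDiff 𝓘(ℝ, E) 𝓘(ℝ, ℝ) 2 f)
    (hG : ContDiffOn ℝ 1 (localMetric g z) (extChartAt 𝓘(ℝ, E) z).target)
    (hz : mfderiv 𝓘(ℝ, E) 𝓘(ℝ, ℝ) f z = 0) {μ Λ : ℝ} (hμ : 0 < μ)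
    (hl : ∀ l ∈ spectrum ℝ (hessOp g f z), μ < l ∧ l < Λ) :
    ∃ V ∈ 𝓝 z, ∀ (T : ℝ) (γ : ℝ → M),
      IsMIntegralCurveOn γ (fun x => -grad g f x) (Ico 0 T) → MapsTo γ (Ico 0 T) V →
      ∀ t ∈ Ico 0 T, Real.exp (-2 * Λ * t) * (f (γ 0) - f z) ≤ f (γ t) - f z ∧
        f (γ t) - f z ≤ Real.exp (-2 * μ * t) * (f (γ 0) - f z) := by
  have hfd := hf.mdifferentiable (by simp)
  obtain ⟨k, P, l, h1, h2, h3⟩ := exists_diagonal_hessOp hg hf hz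
  have h := eventually_rate_le (contDiffAt_localFun hf z) (fderiv_localFun_self hfd hz) h1
    (hasLinearizationAt_neg_grad hg hf hG hz) (localField_neg_grad_self hg hfd hz) h2 hμ
    fun i => hl _ (h3 ▸ ⟨i, rfl⟩)
  refine ⟨_, eventually_mem_source_and_extChartAt
    (h.and (extChartAt_target_mem_nhds (I := 𝓘(ℝ, E)) z)), fun T γ hγ hV => ?_⟩
  refine exp_mul_le_and_le_exp_mul (φ := fun t => f (γ t) - f z) (fun t ht => ?_)
    (φ' := fun t => fderiv ℝ (localFun f z) (extChartAt 𝓘(ℝ, E) z (γ t))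
      (localField (fun x => -grad g f x) z (extChartAt 𝓘(ℝ, E) z (γ t)))) (fun t ht => ?_)
  · obtain ⟨hs, -, hy⟩ := hV ht
    have h4 : DifferentiableAt ℝ (localFun f z) (extChartAt 𝓘(ℝ, E) z (γ t)) :=
      ((contDiffOn_comp_extChartAt_symm hf z).contDiffAt
        ((isOpen_extChartAt_target (I := 𝓘(ℝ, E)) z).mem_nhds hy)).differentiableAt (by simp)
    have h5 := h4.hasFDerivAt.comp_hasDerivWithinAt t (hasDerivWithinAt_extChartAt_comp hγ ht hs)
    refine (h5.congr (f₁ := fun t => f (γ t)) (fun τ hτ => ?_) ?_).sub_const (f z)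
    · exact (localFun_extChartAt (hV hτ).1).symm
    · exact (localFun_extChartAt hs).symm
  · obtain ⟨hs, hr, -⟩ := hV ht
    rwa [localFun_extChartAt hs, localFun_extChartAt (mem_extChartAt_source z)] at hr

/-- A nondegenerate minimum is a stable equilibrium of the gradient flow. -/
theorem isLyapunovStable_of_hessOp_pos [T2Space M] (hg : ∀ x, IsMetricAt g x)
    (hf : ContMDiff 𝓘(ℝ, E) 𝓘(ℝ, ℝ) 2 f)
    (hG : ContDiffOn ℝ 1 (localMetric g z) (extChartAt 𝓘(ℝ, E) z).target)
    (hz : mfderiv 𝓘(ℝ, E) 𝓘(ℝ, ℝ) f z = 0)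
    (hpos : ∀ l ∈ spectrum ℝ (hessOp g f z), 0 < l) :
    IsLyapunovStable (fun x => -grad g f x) z := by
  have : ProperSpace E := FiniteDimensional.proper ℝ E
  have hfd := hf.mdifferentiable (by simp)
  intro W hW
  obtain ⟨c, hc, h⟩ := exists_mul_sq_le_localFun_sub hg hf hz hpos
  set φ := extChartAt 𝓘(ℝ, E) z with hφ
  have hW' : ∀ᶠ y in 𝓝 (φ z), φ.symm y ∈ W := by
    have := (continuousAt_extChartAt_symm (I := 𝓘(ℝ, E)) z).tendsto
    rw [extChartAt_to_inv] at this
    exact this hW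
  obtain ⟨R, hR, hball⟩ := Metric.eventually_nhds_iff_ball.1
    ((h.and hW').and (extChartAt_target_mem_nhds (I := 𝓘(ℝ, E)) z))
  set r := R / 2 with hr
  have hr0 : 0 < r := by positivity
  have hrR : r < R := by rw [hr]; linarith
  have hcb : Metric.closedBall (φ z) r ⊆ Metric.ball (φ z) R := Metric.closedBall_subset_ball hrR
  -- By quadratic growth `f` is at least `δ` on the coordinate sphere of radius `r`.
  set δ := f z + c * r ^ 2 with hδ
  have hδ' : ∀ y, dist y (φ z) = r → δ ≤ localFun f z y := fun y hy => by
    have h1 := (hball y (hcb hy.le)).1.1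
    rw [← dist_eq_norm, hy] at h1
    linarith
  let O : Set M := (φ.source ∩ φ ⁻¹' Metric.ball (φ z) r) ∩ {x | f x < δ}
  have hO : IsOpen O :=
    (isOpen_extChartAt_preimage' (I := 𝓘(ℝ, E)) z Metric.isOpen_ball).inter
      (isOpen_lt hf.continuous continuous_const)
  -- `O` is the open sublevel set inside the coordinate ball and `K` the closed coordinate ball,
  -- closed in `M` because it is compact and `M` is Hausdorff. A point of `K` below the level `δ`
  -- cannot lie on the sphere, so it belongs to `O`.
  let K : Set M := φ.symm '' Metric.closedBall (φ z) r
  have hK : IsClosed K := ((isCompact_closedBall _ _).image_of_continuousOn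
    ((continuousOn_extChartAt_symm (I := 𝓘(ℝ, E)) z).mono fun y hy => (hball y (hcb hy)).2)).isClosed
  have hOK : O ⊆ K := fun x hx =>
    ⟨φ x, Metric.ball_subset_closedBall hx.1.2, φ.left_inv hx.1.1⟩
  have hKO : ∀ x ∈ K, f x < δ → x ∈ O := by
    rintro _ ⟨y, hy, rfl⟩ hlt
    have hyt : y ∈ φ.target := (hball y (hcb hy)).2
    refine ⟨⟨φ.map_target hyt, ?_⟩, hlt⟩
    rw [mem_preimage, φ.right_inv hyt]
    refine lt_of_le_of_ne (Metric.mem_closedBall.1 hy) fun heq => ?_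
    exact (hδ' y heq).not_gt hlt
  have hKW : K ⊆ W := by
    rintro _ ⟨y, hy, rfl⟩
    exact (hball y (hcb hy)).1.2
  have hzO : z ∈ O := by
    refine ⟨⟨mem_extChartAt_source z, Metric.mem_ball_self hr0⟩, ?_⟩
    have : 0 < c * r ^ 2 := by positivity
    change f z < δ
    linarith
  refine ⟨O, hO.mem_nhds hzO, fun x hx => ⟨?_, fun T γ h0 hγ t ht => ?_⟩⟩
  · have hsub : Metric.ball (φ z) R ⊆ φ.target := fun y hy => (hball y hy).2
    obtain ⟨η, hη0, hη⟩ := exists_solution_of_lyapunov (f := localFun f z) hr0 hrR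
      ((contDiffOn_localField_neg_grad hg hf hG).mono hsub)
      (fun y hy => ((contDiffOn_comp_extChartAt_symm hf z).contDiffAt
        ((isOpen_extChartAt_target (I := 𝓘(ℝ, E)) z).mem_nhds (hsub hy))).differentiableAt (by simp))
      (fun y hy => fderiv_localFun_localField_nonpos (hsub hy) hg hfd) hδ' hx.1.2
      (by rw [localFun_extChartAt hx.1.1]; exact hx.2)
    refine ⟨φ.symm ∘ η, ?_, isMIntegralCurveOn_extChartAt_symm_comp fun t ht =>
      ⟨hsub (Metric.ball_subset_ball hrR.le (hη t ht).1), (hη t ht).2⟩⟩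
    rw [Function.comp_apply, hη0, φ.left_inv hx.1.1]
  · have hsub : Icc 0 t ⊆ Ico 0 T := fun τ hτ => ⟨hτ.1, hτ.2.trans_lt ht.2⟩
    have hanti := antitoneOn_comp_gradientLine hg hfd (convex_Ico 0 T) hγ
    have hlt : ∀ τ ∈ Icc 0 t, f (γ τ) < δ := fun τ hτ => by
      have h1 : f (γ τ) ≤ f (γ 0) := hanti (hsub ⟨le_rfl, ht.1⟩) (hsub hτ) hτ.1
      rw [h0] at h1
      exact h1.trans_lt hx.2
    -- An arbitrary solution might leave the chart, so the trapping is topological. As `f < δ` along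
    -- the curve, its image lies in the disjoint open sets `O` and `Kᶜ`; it is connected and meets
    -- `O`, hence stays there.
    have hpre : IsPreconnected (γ '' Icc 0 t) :=
      isPreconnected_Icc.image γ (hγ.continuousOn.mono hsub)
    have h2 : γ '' Icc 0 t ⊆ O := by
      refine hpre.subset_left_of_subset_union hO hK.isOpen_compl
        (disjoint_compl_right_iff_subset.2 hOK) ?_ ⟨γ 0, ⟨0, ⟨le_rfl, ht.1⟩, rfl⟩, h0 ▸ hx⟩
      rintro _ ⟨τ, hτ, rfl⟩
      by_cases hk : γ τ ∈ K
      · exact Or.inl (hKO _ hk (hlt τ hτ))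
      · exact Or.inr hk
    exact hKW (hOK (h2 ⟨t, ⟨ht.1, le_rfl⟩, rfl⟩))

/-- A nondegenerate minimum attracts nearby gradient lines. -/
theorem isLocallyAttracting_of_hessOp_pos [T2Space M] (hg : ∀ x, IsMetricAt g x)
    (hf : ContMDiff 𝓘(ℝ, E) 𝓘(ℝ, ℝ) 2 f)
    (hG : ContDiffOn ℝ 1 (localMetric g z) (extChartAt 𝓘(ℝ, E) z).target)
    (hz : mfderiv 𝓘(ℝ, E) 𝓘(ℝ, ℝ) f z = 0)
    (hpos : ∀ l ∈ spectrum ℝ (hessOp g f z), 0 < l) :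
    IsLocallyAttracting (fun x => -grad g f x) z := by
  obtain ⟨k, P, l, -, -, hspec⟩ := exists_diagonal_hessOp hg hf hz
  obtain ⟨μ, hμ, hμl⟩ := exists_pos_forall_le (a := l) fun i => hpos _ (hspec ▸ ⟨i, rfl⟩)
  obtain ⟨Λ, hΛ⟩ := (finite_range l).bddAbove
  -- The rate bounds must be strict: `μ / 2` lies below all eigenvalues and `Λ + 1` above them. Only
  -- the upper estimate, with exponent `-2 (μ / 2) t = -μ t`, is used.
  obtain ⟨V, hV, hrate⟩ := exists_nhds_rate hg hf hG hz (half_pos hμ) (Λ := Λ + 1) fun a ha => by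
    rw [hspec] at ha
    obtain ⟨i, rfl⟩ := ha
    exact ⟨by linarith [hμl i], by linarith [hΛ ⟨i, rfl⟩]⟩
  obtain ⟨c, hc, hlow⟩ := exists_mul_sq_le_localFun_sub hg hf hz hpos
  set φ := extChartAt 𝓘(ℝ, E) z with hφ
  obtain ⟨O, hO, hstab⟩ := isLyapunovStable_of_hessOp_pos hg hf hG hz hpos _
    (inter_mem hV (eventually_mem_source_and_extChartAt hlow))
  refine ⟨O, hO, fun γ h0 hγ => ?_⟩
  -- Stability concerns the half-open intervals `[0, T)`; `T = t + 1` makes `t` admissible.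
  have hmem : ∀ t, 0 ≤ t → γ t ∈ V ∧ γ t ∈ φ.source ∧
      c * ‖φ (γ t) - φ z‖ ^ 2 ≤ localFun f z (φ (γ t)) - f z := fun t ht =>
    (hstab _ h0).2 (t + 1) γ rfl (hγ.mono Ico_subset_Ici_self) t ⟨ht, by linarith⟩
  have hdec : ∀ t, 0 ≤ t → f (γ t) - f z ≤ Real.exp (-μ * t) * (f (γ 0) - f z) := fun t ht => by
    have h1 := (hrate (t + 1) γ (hγ.mono Ico_subset_Ici_self) (fun τ hτ => (hmem τ hτ.1).1) t
      ⟨ht, by linarith⟩).2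
    have h2 : -2 * (μ / 2) * t = -μ * t := by ring
    rwa [h2] at h1
  have hsq : ∀ t, 0 ≤ t → ‖φ (γ t) - φ z‖ ^ 2 ≤ Real.exp (-μ * t) * (f (γ 0) - f z) / c :=
    fun t ht => by
      obtain ⟨-, hs, h2⟩ := hmem t ht
      rw [localFun_extChartAt hs] at h2
      rw [le_div_iff₀ hc, mul_comm]
      exact h2.trans (hdec t ht)
  have hexp : Tendsto (fun t => Real.exp (-μ * t) * (f (γ 0) - f z) / c) atTop (𝓝 0) := by
    have h1 : Tendsto (fun t : ℝ => Real.exp (-μ * t)) atTop (𝓝 0) :=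
      Real.tendsto_exp_atBot.comp (tendsto_id.const_mul_atTop_of_neg (neg_neg_of_pos hμ))
    simpa using (h1.mul_const (f (γ 0) - f z)).div_const c
  have hlim : Tendsto (fun t => ‖φ (γ t) - φ z‖ ^ 2) atTop (𝓝 0) :=
    tendsto_of_tendsto_of_tendsto_of_le_of_le' tendsto_const_nhds hexp
      (Eventually.of_forall fun t => by positivity)
      ((eventually_ge_atTop 0).mono hsq)
  have hlim' : Tendsto (fun t => φ (γ t)) atTop (𝓝 (φ z)) := by
    rw [tendsto_iff_norm_sub_tendsto_zero]
    have := hlim.sqrt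
    simpa [Real.sqrt_sq] using this
  have hsymm : Tendsto φ.symm (𝓝 (φ z)) (𝓝 z) := by
    have := (continuousAt_extChartAt_symm (I := 𝓘(ℝ, E)) z).tendsto
    rwa [extChartAt_to_inv] at this
  refine (hsymm.comp hlim').congr' ?_
  filter_upwards [eventually_ge_atTop 0] with t ht
  exact φ.left_inv (hmem t ht).2.1

/-- A critical point whose Hessian has a negative eigenvalue is unstable for the gradient flow. -/
theorem isUnstable_of_hessOp_neg (hg : ∀ x, IsMetricAt g x)
    (hf : ContMDiff 𝓘(ℝ, E) 𝓘(ℝ, ℝ) 2 f)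
    (hG : ContDiffOn ℝ 1 (localMetric g z) (extChartAt 𝓘(ℝ, E) z).target)
    (hz : mfderiv 𝓘(ℝ, E) 𝓘(ℝ, ℝ) f z = 0)
    (hneg : ∃ l ∈ spectrum ℝ (hessOp g f z), l < 0) :
    IsUnstable (fun x => -grad g f x) z := by
  have hfd := hf.mdifferentiable (by simp)
  obtain ⟨k, P, l, -, h2, h3⟩ := exists_diagonal_hessOp hg hf hz
  obtain ⟨α, Q, u, hα, hQ, hQu, hinc⟩ := exists_chetaev (P := P)
    (hasLinearizationAt_neg_grad hg hf hG hz) (localField_neg_grad_self hg hfd hz) h2 (by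
      obtain ⟨_, ha, ha'⟩ := hneg
      rw [h3] at ha
      obtain ⟨i, rfl⟩ := ha
      exact ⟨i, ha'⟩)
  set φ := extChartAt 𝓘(ℝ, E) z with hφ
  obtain ⟨R, hR, hball⟩ := Metric.eventually_nhds_iff_ball.1
    (hinc.and (extChartAt_target_mem_nhds (I := 𝓘(ℝ, E)) z))
  have hr0 : 0 < R / 2 := by positivity
  have hrR : R / 2 < R := by linarith
  have hsub : Metric.ball (φ z) R ⊆ φ.target := fun y hy => (hball y hy).2
  have hsub' : Metric.closedBall (φ z) (R / 2) ⊆ φ.target :=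
    (Metric.closedBall_subset_ball hrR).trans hsub
  -- The ball is open and the exit point lies on its sphere in the chart, hence outside this
  -- neighbourhood.
  refine ⟨{x | x ∈ φ.source ∧ φ x ∈ Metric.ball (φ z) (R / 2)},
    eventually_mem_source_and_extChartAt (Metric.ball_mem_nhds _ hr0), fun O hO => ?_⟩
  have hsymm : Tendsto φ.symm (𝓝 (φ z)) (𝓝 z) := by
    have := (continuousAt_extChartAt_symm (I := 𝓘(ℝ, E)) z).tendsto
    rwa [extChartAt_to_inv] at this
  have hline : Tendsto (fun t : ℝ => φ z + t • u) (𝓝[≠] 0) (𝓝 (φ z)) := by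
    have : Continuous fun t : ℝ => φ z + t • u := by fun_prop
    simpa using this.continuousAt.tendsto.mono_left (nhdsWithin_le_nhds (a := (0 : ℝ)))
  -- Initial points are taken on the line through `φ z` with direction `u`: arbitrarily close to the
  -- centre, and with `Q > 0`.
  obtain ⟨t, ⟨ht1, ht2⟩, ht3⟩ := ((hline.eventually ((hsymm.eventually hO).and
    (Metric.ball_mem_nhds _ hr0))).and self_mem_nhdsWithin).exists
  obtain ⟨η, h0, T, hT, hd, hη⟩ := exists_solution_exit_of_chetaev hr0 hrR
    ((contDiffOn_localField_neg_grad hg hf hG).mono hsub) hQ hα (fun y hy => (hball y hy).1)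
    ht2 (hQu t ht3)
  refine ⟨φ.symm ∘ η, T, hT.le, ?_, isMIntegralCurveOn_extChartAt_symm_comp fun τ hτ =>
      ⟨hsub' (hη τ hτ).1, (hη τ hτ).2⟩, fun hmem => ?_⟩
  · rw [Function.comp_apply, h0]
    exact ht1
  · have h4 : φ (φ.symm (η T)) ∈ Metric.ball (φ z) (R / 2) := hmem.2
    rw [φ.right_inv (hsub' (hη T ⟨hT.le, le_rfl⟩).1), Metric.mem_ball, hd] at h4
    exact lt_irrefl _ h4

end Stability

theorem isMIntegralCurveOn_congr {E : Type*} [NormedAddCommGroup E] [NormedSpace ℝ E]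
    {M : Type*} [TopologicalSpace M] [ChartedSpace E M] {V V' : ∀ x : M, TangentSpace 𝓘(ℝ, E) x}
    {γ : ℝ → M} {J : Set ℝ} (h : ∀ t ∈ J, V (γ t) = V' (γ t)) :
    IsMIntegralCurveOn γ V J ↔ IsMIntegralCurveOn γ V' J :=
  forall₂_congr fun t ht => by rw [h t ht]

-- The form is quadratic in `A`: compose `B` with `A`, exchange the arguments, compose with `A`
-- again and exchange back.
set_option maxSynthPendingDepth 3 in
theorem contDiff_restrictForm {F F' : Type*} [NormedAddCommGroup F] [NormedSpace ℝ F]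
    [NormedAddCommGroup F'] [NormedSpace ℝ F'] (B : F' →L[ℝ] F' →L[ℝ] ℝ) {n : WithTop ℕ∞} :
    ContDiff ℝ n fun A : F →L[ℝ] F' => restrictForm B A := by
  have h1 : ContDiff ℝ n fun T : F →L[ℝ] F' →L[ℝ] ℝ => T.flip :=
    (ContinuousLinearMap.flipₗᵢ ℝ F F' ℝ).contDiff
  have h3 : ContDiff ℝ n fun T : F →L[ℝ] F →L[ℝ] ℝ => T.flip :=
    (ContinuousLinearMap.flipₗᵢ ℝ F F ℝ).contDiff
  have h4 : ContDiff ℝ n fun A : F →L[ℝ] F' => (B ∘L A).flip :=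
    h1.comp (contDiff_const.clm_comp contDiff_id)
  exact h3.comp (h4.clm_comp contDiff_id)

/-! ### The quotient metric and sections of the quotient map. -/

namespace RegularModel

variable {m d n : ℕ} (S : RegularModel m d n)

/-- The definition chooses representatives and lifts and hides smoothness. This formula is free of
choices: the metric is `1/n` times the Euclidean product pulled back along the descended realization
map, which is smooth. -/
theorem quotMetric_apply (x : S.Mreg) (ξ η : Model m d) :
    (S.quotMetric x : Model m d →L[ℝ] Model m d →L[ℝ] ℝ) ξ η =
      1 / n * inner ℝ (S.dphiBar x ξ) (S.dphiBar x η) := by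
  obtain ⟨θ, rfl⟩ := S.q_surjective x
  obtain ⟨u, rfl⟩ := S.dq_surjective θ ξ
  obtain ⟨v, rfl⟩ := S.dq_surjective θ η
  rw [S.dphiBar_dq, S.dphiBar_dq]
  exact S.quotMetric_dq θ u v

/-- The quotient metric is smooth. -/
theorem contDiffOn_localMetric (z : S.Mreg) :
    ContDiffOn ℝ ∞ (localMetric S.quotMetric z) (extChartAt 𝓘(ℝ, Model m d) z).target := by
  have h1 : ContDiffOn ℝ ∞ (fderiv ℝ fun y => S.descend id ((extChartAt 𝓘(ℝ, Model m d) z).symm y))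
      (extChartAt 𝓘(ℝ, Model m d) z).target :=
    (contDiffOn_comp_extChartAt_symm (S.contMDiff_descend contDiff_id) z).fderiv_of_isOpen
      (isOpen_extChartAt_target z) (by simp)
  refine (((contDiff_restrictForm (innerSL ℝ)).comp_contDiffOn h1).const_smul (1 / n : ℝ)).congr
    fun y hy => ?_
  refine ContinuousLinearMap.ext fun u => ContinuousLinearMap.ext fun v => ?_
  rw [localMetric_apply, S.quotMetric_apply]
  have h2 := fderiv_comp_extChartAt_symm (f := S.descend (id : Output n → Output n)) hy
    ((S.contMDiff_descend contDiff_id).mdifferentiable (by simp) _)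
  change _ = 1 / n * inner ℝ
    (fderiv ℝ (fun y => S.descend (id : Output n → Output n) ((extChartAt 𝓘(ℝ, Model m d) z).symm y)) y u)
    (fderiv ℝ (fun y => S.descend (id : Output n → Output n) ((extChartAt 𝓘(ℝ, Model m d) z).symm y)) y v)
  rw [h2]
  rfl

theorem contMDiff_quotLoss {Lt : Output n → ℝ} (hLt : ContDiff ℝ ∞ Lt) :
    ContMDiff 𝓘(ℝ, Model m d) 𝓘(ℝ, ℝ) ∞ (S.quotLoss Lt) := S.contMDiff_descend hLt

/-- The differential of the loss factors through the quotient. -/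
theorem mfderiv_loss {Lt : Output n → ℝ} (hLt : ContDiff ℝ ∞ Lt) (θ : S.Reg) (w : Param m d) :
    mderiv (E := Param m d) (F := ℝ) (S.loss Lt) θ w =
      mderiv (E := Model m d) (F := ℝ) (S.quotLoss Lt) (S.q θ) (S.dq θ w) := by
  have h1 := (S.contMDiff_q θ).mdifferentiableAt (by simp)
  have h2 := (S.contMDiff_quotLoss hLt).mdifferentiable (by simp) (S.q θ)
  exact DFunLike.congr_fun (h2.hasMFDerivAt.comp θ h1.hasMFDerivAt).mfderiv w

section Section

variable {U : Set S.Mreg} {s : S.Mreg → S.Reg}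

/-- The differential of a section. -/
def dsec (s : S.Mreg → S.Reg) (z : S.Mreg) : Model m d →L[ℝ] Param m d :=
  mderiv (E := Model m d) (F := Param m d) s z

theorem hasMFDerivAt_section (hU : IsOpen U)
    (hs : ContMDiffOn 𝓘(ℝ, Model m d) 𝓘(ℝ, Param m d) ∞ s U) {z : S.Mreg} (hz : z ∈ U) :
    HasMFDerivAt 𝓘(ℝ, Model m d) 𝓘(ℝ, Param m d) s z (S.dsec s z) :=
  ((hs.contMDiffAt (hU.mem_nhds hz)).mdifferentiableAt (by simp)).hasMFDerivAt

/-- `q ∘ s` is the identity on a neighbourhood of `z`, as `U` is open, so the relation may be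
differentiated. -/
theorem dq_dsec (hU : IsOpen U) (hs : ContMDiffOn 𝓘(ℝ, Model m d) 𝓘(ℝ, Param m d) ∞ s U)
    (hqs : ∀ z ∈ U, S.q (s z) = z) {z : S.Mreg} (hz : z ∈ U) (u : Model m d) :
    S.dq (s z) (S.dsec s z u) = u := by
  have h1 := ((S.contMDiff_q (s z)).mdifferentiableAt (by simp)).hasMFDerivAt.comp z
    (S.hasMFDerivAt_section hU hs hz)
  have h2 : S.q ∘ s =ᶠ[𝓝 z] id := by
    filter_upwards [hU.mem_nhds hz] with x hx using hqs x hx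
  exact DFunLike.congr_fun (hasMFDerivAt_unique (h1.congr_of_eventuallyEq h2.symm)
    (hasMFDerivAt_id z)) u

theorem gaugeLoss_eq (Lt : Output n → ℝ) (hqs : ∀ z ∈ U, S.q (s z) = z) {z : S.Mreg} (hz : z ∈ U) :
    S.gaugeLoss Lt s z = S.quotLoss Lt z := congrArg (S.quotLoss Lt) (hqs z hz)

/-- The double pullback evaluates `ḡ` at `q (s z) = z` on vectors `Dq (Ds u) = u`. -/
theorem gaugeMetric_eq (hU : IsOpen U) (hs : ContMDiffOn 𝓘(ℝ, Model m d) 𝓘(ℝ, Param m d) ∞ s U)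
    (hqs : ∀ z ∈ U, S.q (s z) = z) {z : S.Mreg} (hz : z ∈ U) :
    S.gaugeMetric s z = S.quotMetric z := by
  have h1 : ∀ x, x = z → ∀ u v : Model m d,
      (S.quotMetric x : Model m d →L[ℝ] Model m d →L[ℝ] ℝ) u v =
        (S.quotMetric z : Model m d →L[ℝ] Model m d →L[ℝ] ℝ) u v := by rintro _ rfl u v; rfl
  refine ContinuousLinearMap.ext fun (u : Model m d) => ContinuousLinearMap.ext
    fun (v : Model m d) => ?_
  change (S.quotMetric (S.q (s z)) : Model m d →L[ℝ] Model m d →L[ℝ] ℝ)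
    (S.dq (s z) (S.dsec s z u)) (S.dq (s z) (S.dsec s z v)) = _
  rw [S.dq_dsec hU hs hqs hz, S.dq_dsec hU hs hqs hz]
  exact h1 _ (hqs z hz) u v

/-- `g(Ds u, Ds v) = ḡ(u, v)`. -/
theorem funMetric_dsec (hU : IsOpen U) (hs : ContMDiffOn 𝓘(ℝ, Model m d) 𝓘(ℝ, Param m d) ∞ s U)
    (hqs : ∀ z ∈ U, S.q (s z) = z) {z : S.Mreg} (hz : z ∈ U) (u v : Model m d) :
    (S.funMetric (s z) : Param m d →L[ℝ] Param m d →L[ℝ] ℝ) (S.dsec s z u) (S.dsec s z v) =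
      (S.quotMetric z : Model m d →L[ℝ] Model m d →L[ℝ] ℝ) u v := by
  have h1 := S.quotMetric_dq (s z) (S.dsec s z u) (S.dsec s z v)
  exact h1.symm.trans (DFunLike.congr_fun (DFunLike.congr_fun (S.gaugeMetric_eq hU hs hqs hz) u) v)

theorem mfderiv_loss_dsec {Lt : Output n → ℝ} (hLt : ContDiff ℝ ∞ Lt) (hU : IsOpen U)
    (hs : ContMDiffOn 𝓘(ℝ, Model m d) 𝓘(ℝ, Param m d) ∞ s U)
    (hqs : ∀ z ∈ U, S.q (s z) = z) {z : S.Mreg} (hz : z ∈ U) (u : Model m d) :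
    mderiv (E := Param m d) (F := ℝ) (S.loss Lt) (s z) (S.dsec s z u) =
      mderiv (E := Model m d) (F := ℝ) (S.quotLoss Lt) z u := by
  rw [S.mfderiv_loss hLt, S.dq_dsec hU hs hqs hz, hqs z hz]

/-- Gradient lines in the quotient are the same as gradient lines in the slice. -/
theorem isMIntegralCurveOn_iff_isSliceGradientFlow {Lt : Output n → ℝ} (hLt : ContDiff ℝ ∞ Lt)
    (hU : IsOpen U) (hs : ContMDiffOn 𝓘(ℝ, Model m d) 𝓘(ℝ, Param m d) ∞ s U)
    (hqs : ∀ z ∈ U, S.q (s z) = z) {J : Set ℝ} {γ : ℝ → S.Mreg} (hγ : MapsTo γ J U) :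
    IsMIntegralCurveOn (I := 𝓘(ℝ, Model m d)) γ
        (fun x => -grad S.quotMetric (S.quotLoss Lt) x) J ↔ S.IsSliceGradientFlow Lt s γ J := by
  refine forall₂_congr fun t ht => ?_
  have hz := hγ ht
  obtain ⟨B, hB⟩ : ∃ B : Model m d →L[ℝ] Model m d →L[ℝ] ℝ, B = S.quotMetric (γ t) := ⟨_, rfl⟩
  obtain ⟨w, hw⟩ : ∃ w : Model m d, w = grad S.quotMetric (S.quotLoss Lt) (γ t) := ⟨_, rfl⟩
  obtain ⟨D, hD⟩ : ∃ D : Model m d →L[ℝ] ℝ,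
    D = mderiv (E := Model m d) (F := ℝ) (S.quotLoss Lt) (γ t) := ⟨_, rfl⟩
  have hgrad : ∀ u, B w u = D u := fun u => by
    rw [hB, hw, hD]; exact apply_grad (S.isMetricAt_quotMetric _) _ u
  have hneg : ∀ u, B (-w) u = -D u := fun u => by
    rw [map_neg, neg_apply, hgrad]
  have hBs : ∀ u v, (S.funMetric (s (γ t)) : Param m d →L[ℝ] Param m d →L[ℝ] ℝ)
      (S.dsec s (γ t) u) (S.dsec s (γ t) v) = B u v := fun u v => by
    rw [hB]; exact S.funMetric_dsec hU hs hqs hz u v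
  have hDs : ∀ u, mderiv (E := Param m d) (F := ℝ) (S.loss Lt) (s (γ t)) (S.dsec s (γ t) u) = D u :=
    fun u => by rw [hD]; exact S.mfderiv_loss_dsec hLt hU hs hqs hz u
  constructor
  · intro h
    have h' : HasMFDerivWithinAt 𝓘(ℝ, ℝ) 𝓘(ℝ, Model m d) γ J t ((1 : ℝ →L[ℝ] ℝ).smulRight (-w)) := by
      rw [hw]; exact h
    -- The velocity on the slice is the image under `Ds` of the velocity downstairs.
    refine ⟨S.dsec s (γ t) (-w), ?_, ⟨-w, rfl⟩, ?_⟩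
    · have h1 := (S.hasMFDerivAt_section hU hs hz).comp_hasMFDerivWithinAt t h'
      have h2 : S.dsec s (γ t) ∘L ((1 : ℝ →L[ℝ] ℝ).smulRight (-w)) =
          (1 : ℝ →L[ℝ] ℝ).smulRight (S.dsec s (γ t) (-w)) := by ext1; simp
      exact HasMFDerivWithinAt.congr_mfderiv h1 h2
    · rintro _ ⟨u, rfl⟩
      exact (hBs (-w) u).trans ((hneg u).trans (congrArg Neg.neg (hDs u).symm))
  · rintro ⟨_, hv, ⟨w', rfl⟩, hv'⟩
    obtain ⟨v, hvw⟩ : ∃ v : Model m d, v = w' := ⟨_, rfl⟩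
    -- Testing on vectors `Ds u` and using that `Ds` is isometric turns the slice equation into the
    -- gradient equation downstairs; positive definiteness then fixes `v`.
    have h0 : ∀ u, B v u = B (-w) u := fun u => by
      rw [hneg, ← hBs, ← hDs, hvw]
      exact hv' _ ⟨u, rfl⟩
    have hww : v = -w := (S.isMetricAt_quotMetric (γ t)).eq_of_apply_eq (by rw [← hB]; exact h0)
    -- Only `s ∘ γ` is known to be differentiable; on `J` the curve `γ` is recovered as `q ∘ s ∘ γ`.
    have h1 := ((S.contMDiff_q (s (γ t))).mdifferentiableAt
      (by simp)).hasMFDerivAt.comp_hasMFDerivWithinAt t hv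
    have h2 : S.dq (s (γ t)) ∘L ((1 : ℝ →L[ℝ] ℝ).smulRight (S.dsec s (γ t) v)) =
        (1 : ℝ →L[ℝ] ℝ).smulRight (-w) := by
      ext1
      simp [S.dq_dsec hU hs hqs hz, hww]
    have h3 : HasMFDerivWithinAt 𝓘(ℝ, ℝ) 𝓘(ℝ, Model m d) (S.q ∘ s ∘ γ) J t
        ((1 : ℝ →L[ℝ] ℝ).smulRight (-w)) := by
      rw [hvw] at h2
      exact HasMFDerivWithinAt.congr_mfderiv h1 h2
    rw [hw] at h3
    exact h3.congr_of_eventuallyEq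
      (eventually_of_mem self_mem_nhdsWithin fun τ hτ => (hqs _ (hγ hτ)).symm) (hqs _ hz).symm

end Section
end RegularModel

end ShallowNet

end

/-! ### The main theorem. -/

theorem mainTheorem10 {m d n : ℕ} (S : ShallowNet.RegularModel m d n)
    (Lt : ShallowNet.Output n → ℝ) (hLt : ContDiff ℝ ∞ Lt)
    (U : Set S.Mreg) (hU : IsOpen U) (s : S.Mreg → S.Reg)
    (hs : ContMDiffOn 𝓘(ℝ, ShallowNet.RegularModel.Model m d) 𝓘(ℝ, ShallowNet.Param m d) ∞ s U)
    (hqs : ∀ z ∈ U, S.q (s z) = z) :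
    -- the gauge-fixed loss is the descended loss on `U`, and the reduced form is a metric on `U`
    (∀ z ∈ U, S.gaugeLoss Lt s z = S.quotLoss Lt z ∧ ShallowNet.IsMetricAt (S.gaugeMetric s) z) ∧
    -- the gradient fields agree on `U`
    (∀ z ∈ U, ShallowNet.grad (S.gaugeMetric s) (S.gaugeLoss Lt s) z =
      ShallowNet.grad S.quotMetric (S.quotLoss Lt) z) ∧
    -- so do the flows: in `U`, and on the slice `s(U)`
    (∀ (J : Set ℝ) (γ : ℝ → S.Mreg), MapsTo γ J U →
      (IsMIntegralCurveOn (I := 𝓘(ℝ, ShallowNet.RegularModel.Model m d)) γ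
          (fun x => -ShallowNet.grad S.quotMetric (S.quotLoss Lt) x) J ↔
        IsMIntegralCurveOn (I := 𝓘(ℝ, ShallowNet.RegularModel.Model m d)) γ
          (fun x => -ShallowNet.grad (S.gaugeMetric s) (S.gaugeLoss Lt s) x) J) ∧
      (IsMIntegralCurveOn (I := 𝓘(ℝ, ShallowNet.RegularModel.Model m d)) γ
          (fun x => -ShallowNet.grad S.quotMetric (S.quotLoss Lt) x) J ↔
        S.IsSliceGradientFlow Lt s γ J)) ∧
    -- at critical points
    (∀ z ∈ U, mfderiv 𝓘(ℝ, ShallowNet.RegularModel.Model m d) 𝓘(ℝ, ℝ) (S.quotLoss Lt) z = 0 →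
      -- the Hessians, the Hessian operators and their spectra agree
      ShallowNet.hess (S.gaugeMetric s) (S.gaugeLoss Lt s) z =
        ShallowNet.hess S.quotMetric (S.quotLoss Lt) z ∧
      ShallowNet.hessOp (S.gaugeMetric s) (S.gaugeLoss Lt s) z =
        ShallowNet.hessOp S.quotMetric (S.quotLoss Lt) z ∧
      spectrum ℝ (ShallowNet.hessOp (S.gaugeMetric s) (S.gaugeLoss Lt s) z) =
        spectrum ℝ (ShallowNet.hessOp S.quotMetric (S.quotLoss Lt) z) ∧
      -- the reduced Hessian is the linearization of the quotient gradient flow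
      ShallowNet.HasLinearizationAt (fun x => -ShallowNet.grad S.quotMetric (S.quotLoss Lt) x) z
        (-ShallowNet.hessOp (S.gaugeMetric s) (S.gaugeLoss Lt s) z) ∧
      -- positive spectrum
      ((∀ l ∈ spectrum ℝ (ShallowNet.hessOp (S.gaugeMetric s) (S.gaugeLoss Lt s) z), 0 < l) →
        -- strict local minimizer, on the quotient and modulo symmetry
        (∀ᶠ x in 𝓝[≠] z, S.quotLoss Lt z < S.quotLoss Lt x) ∧
        (∀ θ : S.Reg, S.q θ = z → ∀ᶠ θ' in 𝓝 θ,
          S.loss Lt θ ≤ S.loss Lt θ' ∧ (S.loss Lt θ' = S.loss Lt θ → S.q θ' = z)) ∧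
        -- asymptotic stability
        ShallowNet.IsLyapunovStable
          (fun x => -ShallowNet.grad S.quotMetric (S.quotLoss Lt) x) z ∧
        ShallowNet.IsLocallyAttracting
          (fun x => -ShallowNet.grad S.quotMetric (S.quotLoss Lt) x) z ∧
        -- rates, given by the extremal eigenvalues
        (∀ μ Λ : ℝ, 0 < μ →
          (∀ l ∈ spectrum ℝ (ShallowNet.hessOp (S.gaugeMetric s) (S.gaugeLoss Lt s) z),
            μ < l ∧ l < Λ) →
          ∃ V ∈ 𝓝 z, ∀ (T : ℝ) (γ : ℝ → S.Mreg),
            IsMIntegralCurveOn (I := 𝓘(ℝ, ShallowNet.RegularModel.Model m d)) γ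
              (fun x => -ShallowNet.grad S.quotMetric (S.quotLoss Lt) x) (Ico 0 T) →
            MapsTo γ (Ico 0 T) V →
            ∀ t ∈ Ico 0 T,
              Real.exp (-2 * Λ * t) * (S.quotLoss Lt (γ 0) - S.quotLoss Lt z) ≤
                S.quotLoss Lt (γ t) - S.quotLoss Lt z ∧
              S.quotLoss Lt (γ t) - S.quotLoss Lt z ≤
                Real.exp (-2 * μ * t) * (S.quotLoss Lt (γ 0) - S.quotLoss Lt z))) ∧
      -- a negative eigenvalue
      ((∃ l ∈ spectrum ℝ (ShallowNet.hessOp (S.gaugeMetric s) (S.gaugeLoss Lt s) z), l < 0) →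
        ShallowNet.IsUnstable
          (fun x => -ShallowNet.grad S.quotMetric (S.quotLoss Lt) x) z)) := by
  have hf2 := (S.contMDiff_quotLoss hLt).of_le (m := 2) (WithTop.coe_le_coe.2 (le_top : (2 : ℕ∞) ≤ ⊤))
  have hg := S.isMetricAt_quotMetric
  have hloss : ∀ z ∈ U, S.gaugeLoss Lt s =ᶠ[𝓝 z] S.quotLoss Lt := fun z hz => by
    filter_upwards [hU.mem_nhds hz] with x hx using S.gaugeLoss_eq Lt hqs hx
  have hmetric : ∀ z ∈ U, S.gaugeMetric s z = S.quotMetric z := fun z hz =>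
    S.gaugeMetric_eq hU hs hqs hz
  have hgrad : ∀ z ∈ U, ShallowNet.grad (S.gaugeMetric s) (S.gaugeLoss Lt s) z =
      ShallowNet.grad S.quotMetric (S.quotLoss Lt) z := fun z hz =>
    ShallowNet.grad_congr (hmetric z hz) (hloss z hz)
  refine ⟨fun z hz => ⟨S.gaugeLoss_eq Lt hqs hz, ?_⟩, hgrad, fun J γ hγ => ⟨?_,
    S.isMIntegralCurveOn_iff_isSliceGradientFlow hLt hU hs hqs hγ⟩, fun z hz hcrit => ?_⟩
  · unfold ShallowNet.IsMetricAt
    rw [hmetric z hz]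
    exact hg z
  · exact ShallowNet.isMIntegralCurveOn_congr fun t ht => congrArg Neg.neg (hgrad _ (hγ ht)).symm
  have hhess : ShallowNet.hess (S.gaugeMetric s) (S.gaugeLoss Lt s) z =
      ShallowNet.hess S.quotMetric (S.quotLoss Lt) z :=
    ShallowNet.hess_congr (by filter_upwards [hU.mem_nhds hz] with x hx using hmetric x hx) (hloss z hz)
  have hop : ShallowNet.hessOp (S.gaugeMetric s) (S.gaugeLoss Lt s) z =
      ShallowNet.hessOp S.quotMetric (S.quotLoss Lt) z := by
    unfold ShallowNet.hessOp
    rw [hhess, hmetric z hz]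
  have hG := (S.contDiffOn_localMetric z).of_le (m := 1) (by simp)
  -- From here on only the quotient metric and the descended loss are involved, and the general
  -- results on gradient flows apply.
  rw [hop]
  refine ⟨hhess, rfl, rfl, ShallowNet.hasLinearizationAt_neg_grad hg hf2 hG hcrit, fun hpos => ?_,
    ShallowNet.isUnstable_of_hessOp_neg hg hf2 hG hcrit⟩
  have hmin := ShallowNet.eventually_lt_of_hessOp_pos hg hf2 hcrit hpos
  refine ⟨hmin, ?_, ShallowNet.isLyapunovStable_of_hessOp_pos hg hf2 hG hcrit hpos,
    ShallowNet.isLocallyAttracting_of_hessOp_pos hg hf2 hG hcrit hpos,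
    fun μ Λ hμ hl => ShallowNet.exists_nhds_rate hg hf2 hG hcrit hμ hl⟩
  rintro θ rfl
  -- The strict minimum is pulled back by the continuous map `q`: the loss is constant on the fibre
  -- of `z`, and off the fibre the inequality is strict.
  filter_upwards [S.continuous_q.continuousAt.eventually (eventually_nhdsWithin_iff.1 hmin)] with θ' hθ'
  by_cases h : S.q θ' = S.q θ
  · exact ⟨(congrArg (S.quotLoss Lt) h).ge, fun _ => h⟩
  · have h1 : S.loss Lt θ < S.loss Lt θ' := hθ' h
    exact ⟨h1.le, fun h2 => absurd h2 h1.ne'⟩
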